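/- **Convergence of two-grid Meta-MgNet for Poisson's equation.** Let $M\ge 1$, $N=2M$, $h=1/N$, and discretize $-\Delta u=f$ on $\Omega=(0,1)^2$ with $u=0$ on $\partial\Omega$ on the uniform $N\times N$ mesh, with one unknown per interior node $p\in\{1,\dots,N-1\}^2$. The scheme is one of the following, and $\mathbf A=\mathbf A_N$ is its matrix: - a finite difference scheme $(\mathbf A v)(p)=h^{-2}\sum_{a,b}K_{a,b}\,v(p+(a,b))$ ($v=0$ on the boundary), where the fixed stencil $K$ is supported in $\{-1,0,1\}^2$ (this includes 5- and 7-point stencils), is symmetric ($K_{-a,-b}=K_{a,b}$), is consistent with $-\Delta$ ($\sum K_{a,b}=0$, $\sum a^2K_{a,b}=\sum b^2K_{a,b}=-2$, $\sum ab\,K_{a,b}=0$), and is elliptic ($\sum K_{a,b}\cos(a\theta+b\varphi)>0$ for $(\theta,\varphi)\in(-\pi,\pi]^2\setminus\{0\}$); - P1 elements on the triangulation obtained by cutting each mesh square along its diagonal parallel to $(1,1)$, or Q1 (bilinear) elements, with $\mathbf A_{pq}=\int_\Omega\nabla\varphi_q\cdot\nabla\varphi_p$ for the nodal basis functions $\varphi_p$.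 Let $\mathbf P$ be the prolongation from the $M\times M$ mesh, $\mathbf P_{pq}=\pi(p-2q)$, where $\pi$ is either the 7-point stencil (weight $1$ at $0$ and $\tfrac12$ at $\pm(1,0),\pm(0,1),\pm(1,1)$) or the 9-point stencil (weights $\pi(a,b)=2^{-|a|-|b|}$ for $|a|,|b|\le1$). Put $\mathbf A_c=\mathbf P^\top\mathbf A\mathbf P$, $\mathbf C=\mathbf P\mathbf A_c^{-1}\mathbf P^\top\mathbf A$, let $\rho_{\mathbf A}$ be the spectral radius of $\mathbf A$, and write $\|v\|_{\mathbf S}^2=v^\top \mathbf S v$. Let the Meta-NN be any map $\mathbf r\mapsto \mathbf G=\mathbf G(\mathbf r)\in\mathbb R^{(N-1)^2\times L}$ such that for each $\mathbf r\ne0$ the columns of $\mathbf G(\mathbf r)$ are linearly independent and $\mathbf r\in\mathrm{range}(\mathbf G(\mathbf r))$; put $\mathbf B_{\mathbf r}=\mathbf G(\mathbf G^\top \mathbf A\mathbf G)^{-1}\mathbf G^\top$ (if $\mathbf G^\top\mathbf A\mathbf G$ is singular, which can happen only for $\mathbf r=0$, put $\mathbf B_{0}=0$). For arbitrary $\mathbf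 u_0$ and $\mathbf A\mathbf u=\mathbf f$, the two-grid Meta-MgNet iteration is $$\mathbf u_{t+\frac12}=\mathbf u_t+\mathbf P\mathbf A_c^{-1}\mathbf P^\top(\mathbf f-\mathbf A\mathbf u_t),\qquad \mathbf r_{t+1}=\mathbf f-\mathbf A\mathbf u_{t+\frac12},\qquad \mathbf u_{t+1}=\mathbf u_{t+\frac12}+\mathbf B_{\mathbf r_{t+1}}\mathbf r_{t+1}.$$ Then the following hold. 1. (Smoother.) There is a constant $c_s>0$, independent of the scheme, the mesh, the Meta-NN and $\mathbf r$, such that for every $\mathbf r$ the matrix $\mathbf B_{\mathbf r}$ is symmetric positive semidefinite, $\mathbf B_{\mathbf r}\mathbf A\mathbf B_{\mathbf r}=\mathbf B_{\mathbf r}$, and $\|\mathbf r\|^2\le c_s\,\rho_{\mathbf A}\,\mathbf r^\top\mathbf B_{\mathbf r}\mathbf r$. 2. (Coarse grid correction.) $\mathbf A$ and $\mathbf A_c$ are symmetric positive definite, $\|(\mathbf I-\mathbf C)v\|_{\mathbf A}^2\le\|v\|_{\mathbf A}^2$ for all $v$, and for each scheme and prolongation there is a constant $c_a>0$, independent of $M$,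 such that $\|(\mathbf I-\mathbf C)v\|_{\mathbf A}^2\le c_a\,\rho_{\mathbf A}^{-1}\|v\|_{\mathbf A^2}^2$ for all $v$. 3. (Convergence.) Whenever $c_a,c_s>0$ are constants for which, on the given mesh, the last inequality of 2 holds for all $v$ and the properties in 1 hold for all $\mathbf r$, the number $\delta=1-\frac1{c_ac_s}$ satisfies $0\le\delta<1$ and $$\|\mathbf u-\mathbf u_t\|_{\mathbf A}\le\delta^{t/2}\,\|\mathbf u-\mathbf u_0\|_{\mathbf A}\qquad\text{for all } t=0,1,2,\dots$$ -/

import Mathlib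

open Matrix

noncomputable section

namespace MetaMgNet

/-! ### The model problem `-Δu = f` on the unit square, `u = 0` on the boundary -/

/-- Interior nodes of the uniform `N × N` mesh of the unit square (mesh size `h = 1 / N`). -/
abbrev Node (N : ℕ) : Type := Fin (N - 1) × Fin (N - 1)

/-- First integer coordinate of a node; it lies in `{1, …, N - 1}`. -/
def xc {N : ℕ} (p : Node N) : ℤ := (p.1 : ℤ) + 1

/-- Second integer coordinate of a node; it lies in `{1, …, N - 1}`. -/
def yc {N : ℕ} (p : Node N) : ℤ := (p.2 : ℤ) + 1

/-- `K` is the (unscaled) stencil of a symmetric finite difference scheme for `-Δ` that uses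
at most the nine points with offsets in `{-1, 0, 1}²` (so five-point and seven-point stencils are
included). The moment conditions say that the scheme is consistent with `-Δ`, i.e. exact on
quadratic polynomials; the last condition is ellipticity of the difference operator (positivity of
its Fourier symbol). -/
structure IsPoissonStencil (K : ℤ → ℤ → ℝ) : Prop where
  support : ∀ a b : ℤ, 1 < |a| ∨ 1 < |b| → K a b = 0
  symm : ∀ a b : ℤ, K (-a) (-b) = K a b
  moment_zero : ∑ a ∈ Finset.Icc (-1 : ℤ) 1, ∑ b ∈ Finset.Icc (-1 : ℤ) 1, K a b = 0
  moment_xx : ∑ a ∈ Finset.Icc (-1 : ℤ) 1, ∑ b ∈ Finset.Icc (-1 : ℤ) 1,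
    K a b * (a : ℝ) ^ 2 = -2
  moment_yy : ∑ a ∈ Finset.Icc (-1 : ℤ) 1, ∑ b ∈ Finset.Icc (-1 : ℤ) 1,
    K a b * (b : ℝ) ^ 2 = -2
  moment_xy : ∑ a ∈ Finset.Icc (-1 : ℤ) 1, ∑ b ∈ Finset.Icc (-1 : ℤ) 1,
    K a b * ((a : ℝ) * (b : ℝ)) = 0
  elliptic : ∀ θ ∈ Set.Ioc (-Real.pi) Real.pi, ∀ φ ∈ Set.Ioc (-Real.pi) Real.pi,
    (θ ≠ 0 ∨ φ ≠ 0) →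
      0 < ∑ a ∈ Finset.Icc (-1 : ℤ) 1, ∑ b ∈ Finset.Icc (-1 : ℤ) 1,
        K a b * Real.cos ((a : ℝ) * θ + (b : ℝ) * φ)

/-- The finite difference matrix: `(A v)(p) = h⁻² ∑ K(a, b) v(p + (a, b))`, where `v` is extended
by zero to the boundary nodes. -/
def fdmMatrix (N : ℕ) (K : ℤ → ℤ → ℝ) : Matrix (Node N) (Node N) ℝ :=
  Matrix.of fun p q => (N : ℝ) ^ 2 * K (xc q - xc p) (yc q - yc p)

/-- The reference P1 hat function at the origin, for the mesh of unit squares cut into triangles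
by the diagonals parallel to `(1, 1)`. -/
def hatP1 (s t : ℝ) : ℝ := max 0 (1 - max (max |s| |t|) |s - t|)

/-- The reference Q1 (bilinear) hat function at the origin. -/
def hatQ1 (s t : ℝ) : ℝ := max 0 (1 - |s|) * max 0 (1 - |t|)

/-- The nodal basis function of the node `p`, generated by translation and scaling. -/
def basisFun (N : ℕ) (hat : ℝ → ℝ → ℝ) (p : Node N) (s t : ℝ) : ℝ :=
  hat ((N : ℝ) * s - (xc p : ℝ)) ((N : ℝ) * t - (yc p : ℝ))

/-- The stiffness matrix `∫_Ω ∇φ_q · ∇φ_p` over the unit square `Ω`. The basis functions are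
piecewise polynomial, so the pointwise partial derivatives are the weak ones almost everywhere. -/
def stiffnessMatrix (N : ℕ) (hat : ℝ → ℝ → ℝ) : Matrix (Node N) (Node N) ℝ :=
  Matrix.of fun p q => ∫ t in (0 : ℝ)..1, ∫ s in (0 : ℝ)..1,
    (deriv (fun x => basisFun N hat q x t) s * deriv (fun x => basisFun N hat p x t) s +
      deriv (fun y => basisFun N hat q s y) t * deriv (fun y => basisFun N hat p s y) t)

/-- The discretizations: finite differences, P1 elements, Q1 elements. -/
inductive Scheme : Type
  | fdm (K : ℤ → ℤ → ℝ) (hK : IsPoissonStencil K) : Scheme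
  | femP1 : Scheme
  | femQ1 : Scheme

/-- The system matrix `A` of a discretization on the `N × N` mesh. -/
def Scheme.matrix (d : Scheme) (N : ℕ) : Matrix (Node N) (Node N) ℝ :=
  match d with
  | .fdm K _ => fdmMatrix N K
  | .femP1 => stiffnessMatrix N hatP1
  | .femQ1 => stiffnessMatrix N hatQ1

/-! ### Prolongations -/

/-- The two interpolation stencils. -/
inductive Prolongation : Type
  | sevenPoint : Prolongation
  | ninePoint : Prolongation

/-- Seven-point stencil: weight `1` at the origin and `1/2` at `±(1,0)`, `±(0,1)`, `±(1,1)`.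
Nine-point stencil: weights `1`, `1/2` (edges), `1/4` (corners). -/
def Prolongation.stencil (π : Prolongation) (a b : ℤ) : ℝ :=
  match π with
  | .sevenPoint =>
      if a = 0 ∧ b = 0 then 1
      else if |a| ≤ 1 ∧ |b| ≤ 1 ∧ |a - b| ≤ 1 then 1 / 2 else 0
  | .ninePoint =>
      if a = 0 ∧ b = 0 then 1
      else if |a| + |b| = 1 then 1 / 2
      else if |a| = 1 ∧ |b| = 1 then 1 / 4 else 0

/-- The prolongation matrix `P` from the `M × M` mesh to the `2M × 2M` mesh; the coarse node `q`
is the fine node with coordinates `2 q`. -/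
def Prolongation.matrix (π : Prolongation) (M : ℕ) : Matrix (Node (2 * M)) (Node M) ℝ :=
  Matrix.of fun p q => π.stencil (xc p - 2 * xc q) (yc p - 2 * yc q)

/-! ### Norms, coarse grid correction, smoother, iteration -/

section Abstract

variable {ι κ μ : Type} [Fintype ι] [DecidableEq ι] [Fintype κ] [DecidableEq κ]
  [Fintype μ] [DecidableEq μ]

/-- The norm `‖v‖_A = √(vᵀ A v)` of a symmetric positive definite matrix `A`. -/
def energyNorm (A : Matrix ι ι ℝ) (v : ι → ℝ) : ℝ := Real.sqrt (v ⬝ᵥ (A *ᵥ v))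

/-- The spectral radius `ρ_A` of a (symmetric) real matrix. -/
def rho (A : Matrix ι ι ℝ) : ℝ := (spectralRadius ℝ A).toReal

/-- The Galerkin coarse grid matrix `A_c = Pᵀ A P`. -/
def coarseMatrix (A : Matrix ι ι ℝ) (P : Matrix ι κ ℝ) : Matrix κ κ ℝ := Pᵀ * A * P

/-- The operator `C = P A_c⁻¹ Pᵀ A`. -/
def coarseCorrection (A : Matrix ι ι ℝ) (P : Matrix ι κ ℝ) : Matrix ι ι ℝ :=
  P * (coarseMatrix A P)⁻¹ * Pᵀ * A

/-- Stability: `‖(I - C) v‖_A² ≤ ‖v‖_A²`. -/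
def Stability (A : Matrix ι ι ℝ) (P : Matrix ι κ ℝ) : Prop :=
  ∀ v : ι → ℝ, energyNorm A ((1 - coarseCorrection A P) *ᵥ v) ^ 2 ≤ energyNorm A v ^ 2

/-- Approximation property: `‖(I - C) v‖_A² ≤ c_a ρ_A⁻¹ ‖v‖_{A²}²`. -/
def Approximation (A : Matrix ι ι ℝ) (P : Matrix ι κ ℝ) (ca : ℝ) : Prop :=
  ∀ v : ι → ℝ, energyNorm A ((1 - coarseCorrection A P) *ᵥ v) ^ 2 ≤
    ca * (rho A)⁻¹ * energyNorm (A ^ 2) v ^ 2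

/-- The subspace correction smoother `B = G (Gᵀ A G)⁻¹ Gᵀ`. -/
def smoother (A : Matrix ι ι ℝ) (G : Matrix ι μ ℝ) : Matrix ι ι ℝ :=
  G * (Gᵀ * A * G)⁻¹ * Gᵀ

/-- A Meta-NN `r ↦ G(r)` is admissible if, for every nonzero residual `r`, the columns of `G(r)`
are linearly independent and `r` lies in the range of `G(r)`. -/
def Admissible (𝒢 : (ι → ℝ) → Matrix ι μ ℝ) : Prop :=
  ∀ r : ι → ℝ, r ≠ 0 →
    LinearIndependent ℝ (fun l : μ => fun i : ι => 𝒢 r i l) ∧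
      r ∈ LinearMap.range (Matrix.mulVecLin (𝒢 r))

/-- Smoother property with constant `c_s`: for every residual `r`, the matrix `B_r` is symmetric
positive semidefinite, `B_r A B_r = B_r` and `‖r‖² ≤ c_s ρ_A rᵀ B_r r`. -/
def SmootherProperty (A : Matrix ι ι ℝ) (𝒢 : (ι → ℝ) → Matrix ι μ ℝ) (cs : ℝ) : Prop :=
  ∀ r : ι → ℝ,
    (smoother A (𝒢 r)).PosSemidef ∧
    smoother A (𝒢 r) * A * smoother A (𝒢 r) = smoother A (𝒢 r) ∧
    r ⬝ᵥ r ≤ cs * rho A * (r ⬝ᵥ (smoother A (𝒢 r) *ᵥ r))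

/-- One two-grid step: coarse grid correction, then one meta-smoothing step whose smoother is
determined by the current residual. -/
def step (A : Matrix ι ι ℝ) (P : Matrix ι κ ℝ) (𝒢 : (ι → ℝ) → Matrix ι μ ℝ)
    (f u : ι → ℝ) : ι → ℝ :=
  let uHalf := u + P *ᵥ ((coarseMatrix A P)⁻¹ *ᵥ (Pᵀ *ᵥ (f - A *ᵥ u)))
  let r := f - A *ᵥ uHalf
  uHalf + smoother A (𝒢 r) *ᵥ r

/-- The Meta-MgNet sequence `u_t` with initial guess `u₀`. -/
def iterates (A : Matrix ι ι ℝ) (P : Matrix ι κ ℝ) (𝒢 : (ι → ℝ) → Matrix ι μ ℝ)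
    (f u₀ : ι → ℝ) : ℕ → ι → ℝ
  | 0 => u₀
  | t + 1 => step A P 𝒢 f (iterates A P 𝒢 f u₀ t)

end Abstract

end MetaMgNet

end

/-! The error of the two-grid iteration is multiplied by two energy-orthogonal projections in turn:
`1 - C`, and `1 - B_r A` with `r` the current residual. If `e` lies in the range of `1 - C`, then
Pythagoras gives `‖e - B_r A e‖²_A = ‖e‖²_A - rᵀ B_r r` with `r = A e`, while the approximation
inequality, applied to `e = (1 - C) e`, and the smoother inequality give
`‖e‖²_A ≤ ca ρ⁻¹ ‖r‖² ≤ ca cs rᵀ B_r r`. Hence each step contracts the squared error by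
`1 - 1 / (ca * cs)`. One may take `cs = 1`, since `A ≤ ρ`, and `B_r A r = r` because `r` lies in the
range of `G r`.

For the approximation inequality, every scheme is a positive multiple of a member of the family
`L ⊗ 1 + 1 ⊗ L + γ L ⊗ L` with `γ > -1/2` and `L` the one-dimensional difference operator
(`γ = K 1 1` for the finite differences, `0` for P1 and `-1/3` for Q1). Each member of the family
dominates a multiple of the five-point operator. Since `C` is the energy-orthogonal projection onto
the range of `P`, the coarse grid correction does at least as well as interpolating the values of
`v` at the coarse nodes, and the error of that interpolation is bounded by the second differences
of `v`. -/

namespace MetaMgNet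

/-! ### Energy norms and the spectral radius -/

section EnergyNorm

theorem isSymm_of_posSemidef {ι : Type*} {A : Matrix ι ι ℝ} (hA : A.PosSemidef) : A.IsSymm :=
  isHermitian_iff_isSymm.mp hA.isHermitian

variable {ι : Type} [Fintype ι]

theorem dotProduct_mulVec_comm {A : Matrix ι ι ℝ} (hA : A.IsSymm) (v w : ι → ℝ) :
    v ⬝ᵥ A *ᵥ w = w ⬝ᵥ A *ᵥ v := by
  rw [← dotProduct_transpose_mulVec, hA.eq]

theorem energyNorm_nonneg (A : Matrix ι ι ℝ) (v : ι → ℝ) : 0 ≤ energyNorm A v :=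
  Real.sqrt_nonneg _

theorem energyNorm_sq {A : Matrix ι ι ℝ} (hA : A.PosSemidef) (v : ι → ℝ) :
    energyNorm A v ^ 2 = v ⬝ᵥ A *ᵥ v :=
  Real.sq_sqrt (hA.dotProduct_mulVec_nonneg v)

variable [DecidableEq ι]

theorem energyNorm_pow_two_sq {A : Matrix ι ι ℝ} (hA : A.IsSymm) (v : ι → ℝ) :
    energyNorm (A ^ 2) v ^ 2 = A *ᵥ v ⬝ᵥ A *ᵥ v := by
  have hquad : v ⬝ᵥ (A ^ 2) *ᵥ v = A *ᵥ v ⬝ᵥ A *ᵥ v := by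
    rw [pow_two, ← mulVec_mulVec, dotProduct_mulVec_comm hA]
  rw [energyNorm, hquad]
  exact Real.sq_sqrt (dotProduct_star_self_nonneg (A *ᵥ v))

theorem abs_le_rho {A : Matrix ι ι ℝ} {k : ℝ} (hk : k ∈ spectrum ℝ A) : |k| ≤ rho A := by
  have hbdd : BddAbove ((fun l : ℝ => ‖l‖₊) '' spectrum ℝ A) :=
    ((finite_real_spectrum (A := A)).image _).bddAbove
  obtain ⟨b, hb⟩ := hbdd
  have hfinite : spectralRadius ℝ A ≠ ⊤ :=
    ne_top_of_le_ne_top (b := (b : ENNReal)) ENNReal.coe_ne_top <|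
      iSup₂_le fun l hl => ENNReal.coe_le_coe.2 (hb ⟨l, hl, rfl⟩)
  have hle : (‖k‖₊ : ENNReal) ≤ spectralRadius ℝ A :=
    le_iSup₂ (f := fun (l : ℝ) (_ : l ∈ spectrum ℝ A) => (‖l‖₊ : ENNReal)) k hk
  simpa [rho] using ENNReal.toReal_mono hfinite hle

theorem rho_le {A : Matrix ι ι ℝ} {R : ℝ} (hR : 0 ≤ R) (h : ∀ k ∈ spectrum ℝ A, |k| ≤ R) :
    rho A ≤ R := by
  refine ENNReal.toReal_le_of_le_ofReal hR (iSup₂_le fun k hk => ?_)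
  rw [← enorm_eq_nnnorm, ← ofReal_norm, Real.norm_eq_abs]
  exact ENNReal.ofReal_le_ofReal (h k hk)

theorem rho_nonneg (A : Matrix ι ι ℝ) : 0 ≤ rho A := ENNReal.toReal_nonneg

theorem rho_pos [Nonempty ι] {A : Matrix ι ι ℝ} (hA : A.PosDef) : 0 < rho A := by
  obtain ⟨i⟩ := ‹Nonempty ι›
  calc 0 < hA.isHermitian.eigenvalues i := hA.eigenvalues_pos i
    _ ≤ |hA.isHermitian.eigenvalues i| := le_abs_self _
    _ ≤ rho A := abs_le_rho (hA.isHermitian.eigenvalues_mem_spectrum_real i)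

theorem mem_spectrum_smul_one_sub_iff {A : Matrix ι ι ℝ} {R k : ℝ} :
    k ∈ spectrum ℝ (R • (1 : Matrix ι ι ℝ) - A) ↔ R - k ∈ spectrum ℝ A := by
  rw [← Algebra.algebraMap_eq_smul_one, ← spectrum.singleton_sub_eq]
  simp only [Set.singleton_sub, Set.mem_image]
  exact ⟨by rintro ⟨l, hl, rfl⟩; simpa using hl, fun h => ⟨_, h, sub_sub_cancel R k⟩⟩

theorem posSemidef_rho_smul_one_sub {A : Matrix ι ι ℝ} (hA : A.IsSymm) :
    (rho A • (1 : Matrix ι ι ℝ) - A).PosSemidef := by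
  refine posSemidef_iff_isHermitian_and_spectrum_nonneg.2
    ⟨isHermitian_iff_isSymm.2 ((isSymm_one.smul _).sub hA), fun k hk => ?_⟩
  have := (le_abs_self _).trans (abs_le_rho (mem_spectrum_smul_one_sub_iff.1 hk))
  simpa using this

theorem dotProduct_mulVec_le_rho {A : Matrix ι ι ℝ} (hA : A.IsSymm) (v : ι → ℝ) :
    v ⬝ᵥ A *ᵥ v ≤ rho A * (v ⬝ᵥ v) := by
  have h : 0 ≤ v ⬝ᵥ (rho A • (1 : Matrix ι ι ℝ) - A) *ᵥ v :=
    (posSemidef_rho_smul_one_sub hA).dotProduct_mulVec_nonneg v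
  rwa [sub_mulVec, smul_mulVec, one_mulVec, dotProduct_sub, dotProduct_smul, smul_eq_mul,
    sub_nonneg] at h

theorem rho_le_of_posSemidef {A : Matrix ι ι ℝ} {R : ℝ} (hR : 0 ≤ R) (hA : A.PosSemidef)
    (h : (R • (1 : Matrix ι ι ℝ) - A).PosSemidef) : rho A ≤ R := by
  refine rho_le hR fun k hk => ?_
  have hk₀ : 0 ≤ k := (posSemidef_iff_isHermitian_and_spectrum_nonneg.1 hA).2 hk
  have hkR : 0 ≤ R - k := (posSemidef_iff_isHermitian_and_spectrum_nonneg.1 h).2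
    (mem_spectrum_smul_one_sub_iff.2 (by rwa [sub_sub_cancel]))
  rwa [abs_of_nonneg hk₀, ← sub_nonneg]

end EnergyNorm

/-! ### Subspace corrections -/

section SubspaceCorrection

variable {ι κ μ : Type} [Fintype ι] [Fintype κ] [Fintype μ]

theorem coarseMatrix_posDef {A : Matrix ι ι ℝ} (hA : A.PosDef) {P : Matrix ι κ ℝ}
    (hP : Function.Injective P.mulVec) : (coarseMatrix A P).PosDef := by
  simpa [coarseMatrix] using hA.conjTranspose_mul_mul_same hP

variable [DecidableEq κ] [DecidableEq μ]

theorem coarseCorrection_eq_smoother_mul (A : Matrix ι ι ℝ) (P : Matrix ι κ ℝ) :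
    coarseCorrection A P = smoother A P * A := rfl

theorem coarseCorrection_mul_prolongation {A : Matrix ι ι ℝ} {P : Matrix ι κ ℝ}
    (hAc : IsUnit (coarseMatrix A P)) : coarseCorrection A P * P = P := by
  calc coarseCorrection A P * P = P * ((coarseMatrix A P)⁻¹ * coarseMatrix A P) := by
        simp only [coarseCorrection, coarseMatrix, Matrix.mul_assoc]
    _ = P := by rw [nonsing_inv_mul _ ((isUnit_iff_isUnit_det _).1 hAc), Matrix.mul_one]

theorem smoother_posSemidef {A : Matrix ι ι ℝ} (hA : A.PosSemidef) (G : Matrix ι μ ℝ) :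
    (smoother A G).PosSemidef := by
  have hc : (Gᵀ * A * G)⁻¹.PosSemidef := by
    simpa using (hA.conjTranspose_mul_mul_same G).inv
  simpa [smoother] using hc.mul_mul_conjTranspose_same G

theorem smoother_mul_mul_smoother (A : Matrix ι ι ℝ) (G : Matrix ι μ ℝ) :
    smoother A G * A * smoother A G = smoother A G := by
  by_cases h : IsUnit (Gᵀ * A * G).det
  · calc smoother A G * A * smoother A G
        = G * ((Gᵀ * A * G)⁻¹ * (Gᵀ * A * G)) * (Gᵀ * A * G)⁻¹ * Gᵀ := by
          simp only [smoother, Matrix.mul_assoc]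
      _ = smoother A G := by rw [nonsing_inv_mul _ h, Matrix.mul_one, smoother]
  · simp only [smoother, nonsing_inv_apply_not_isUnit _ h, Matrix.mul_zero, Matrix.zero_mul]

theorem isIdempotentElem_coarseCorrection (A : Matrix ι ι ℝ) (P : Matrix ι κ ℝ) :
    IsIdempotentElem (coarseCorrection A P) := by
  rw [IsIdempotentElem, coarseCorrection_eq_smoother_mul, ← Matrix.mul_assoc,
    smoother_mul_mul_smoother]

-- Pythagoras: `B A` is the energy-orthogonal projection onto the range of `B`.
theorem energyNorm_sub_mulVec_sq {A B : Matrix ι ι ℝ} (hA : A.PosSemidef) (hB : B.IsSymm)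
    (hBAB : B * A * B = B) (e : ι → ℝ) :
    energyNorm A (e - B *ᵥ A *ᵥ e) ^ 2 = energyNorm A e ^ 2 - A *ᵥ e ⬝ᵥ B *ᵥ A *ᵥ e := by
  have hsymm := isSymm_of_posSemidef hA
  have hcross : e ⬝ᵥ A *ᵥ B *ᵥ A *ᵥ e = A *ᵥ e ⬝ᵥ B *ᵥ A *ᵥ e := by
    rw [dotProduct_mulVec_comm hsymm, dotProduct_comm]
  have hsquare : B *ᵥ A *ᵥ e ⬝ᵥ A *ᵥ B *ᵥ A *ᵥ e = A *ᵥ e ⬝ᵥ B *ᵥ A *ᵥ e := by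
    rw [dotProduct_comm, dotProduct_mulVec_comm hB]
    simp only [mulVec_mulVec, ← Matrix.mul_assoc, hBAB]
  rw [energyNorm_sq hA, energyNorm_sq hA, mulVec_sub, dotProduct_sub, sub_dotProduct,
    sub_dotProduct, hcross, hsquare, dotProduct_comm (B *ᵥ A *ᵥ e)]
  ring

theorem dotProduct_mulVec_mulVec_le_energyNorm_sq {A B : Matrix ι ι ℝ} (hA : A.PosSemidef)
    (hB : B.IsSymm) (hBAB : B * A * B = B) (e : ι → ℝ) :
    A *ᵥ e ⬝ᵥ B *ᵥ A *ᵥ e ≤ energyNorm A e ^ 2 := by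
  rw [← sub_nonneg, ← energyNorm_sub_mulVec_sq hA hB hBAB]
  exact sq_nonneg _

theorem smoother_mulVec_mulVec {A : Matrix ι ι ℝ} (hA : A.PosDef) {G : Matrix ι μ ℝ}
    (hG : LinearIndependent ℝ (fun l i => G i l)) {r : ι → ℝ}
    (hr : r ∈ LinearMap.range G.mulVecLin) : smoother A G *ᵥ A *ᵥ r = r := by
  obtain ⟨y, rfl⟩ := hr
  have hGAG : IsUnit (coarseMatrix A G) :=
    (coarseMatrix_posDef hA (mulVec_injective_iff.2 hG)).isUnit
  rw [mulVecLin_apply, mulVec_mulVec, ← coarseCorrection_eq_smoother_mul, mulVec_mulVec,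
    coarseCorrection_mul_prolongation hGAG]

-- Expand `0 ≤ (R r - A r)ᵀ B (R r - A r)`.
theorem dotProduct_self_le_of_mulVec_mulVec_eq {A B : Matrix ι ι ℝ} (hB : B.PosSemidef)
    {r : ι → ℝ} (hBAr : B *ᵥ A *ᵥ r = r) {R : ℝ} (hR : 0 < R)
    (hAr : r ⬝ᵥ A *ᵥ r ≤ R * (r ⬝ᵥ r)) : r ⬝ᵥ r ≤ R * (r ⬝ᵥ B *ᵥ r) := by
  have hcross : A *ᵥ r ⬝ᵥ B *ᵥ r = r ⬝ᵥ r := by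
    rw [dotProduct_mulVec_comm (isSymm_of_posSemidef hB), hBAr]
  have hsquare : 0 ≤ (R • r - A *ᵥ r) ⬝ᵥ B *ᵥ (R • r - A *ᵥ r) :=
    hB.dotProduct_mulVec_nonneg _
  rw [mulVec_sub, mulVec_smul, hBAr, sub_dotProduct, dotProduct_sub, dotProduct_sub] at hsquare
  simp only [smul_dotProduct, dotProduct_smul, hcross, dotProduct_comm (A *ᵥ r) r,
    smul_eq_mul] at hsquare
  have : 0 ≤ R * (R * (r ⬝ᵥ B *ᵥ r) - r ⬝ᵥ r) := by linarith
  exact sub_nonneg.1 (nonneg_of_mul_nonneg_right this hR)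

variable [DecidableEq ι]

theorem one_sub_coarseCorrection_mulVec (A : Matrix ι ι ℝ) (P : Matrix ι κ ℝ) (v : ι → ℝ) :
    (1 - coarseCorrection A P) *ᵥ v = v - smoother A P *ᵥ A *ᵥ v := by
  rw [coarseCorrection_eq_smoother_mul, sub_mulVec, one_mulVec, mulVec_mulVec]

theorem stability_of_posSemidef {A : Matrix ι ι ℝ} (hA : A.PosSemidef) (P : Matrix ι κ ℝ) :
    Stability A P := by
  intro v
  have hB := smoother_posSemidef hA P
  rw [one_sub_coarseCorrection_mulVec, energyNorm_sub_mulVec_sq hA (isSymm_of_posSemidef hB)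
    (smoother_mul_mul_smoother A P), sub_le_self_iff]
  exact hB.dotProduct_mulVec_nonneg _

theorem energyNorm_one_sub_coarseCorrection_sq_le {A : Matrix ι ι ℝ} (hA : A.PosSemidef)
    {P : Matrix ι κ ℝ} (hAc : IsUnit (coarseMatrix A P)) (v : ι → ℝ) (w : κ → ℝ) :
    energyNorm A ((1 - coarseCorrection A P) *ᵥ v) ^ 2 ≤ energyNorm A (v - P *ᵥ w) ^ 2 := by
  have hPw : (1 - coarseCorrection A P) *ᵥ P *ᵥ w = 0 := by
    rw [mulVec_mulVec, Matrix.sub_mul, coarseCorrection_mul_prolongation hAc, Matrix.one_mul,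
      sub_self, zero_mulVec]
  have h := stability_of_posSemidef hA P (v - P *ᵥ w)
  rwa [mulVec_sub, hPw, sub_zero] at h

theorem approximation_of_forall_exists {A : Matrix ι ι ℝ} (hA : A.PosSemidef)
    {P : Matrix ι κ ℝ} (hAc : IsUnit (coarseMatrix A P)) {c : ℝ}
    (h : ∀ v : ι → ℝ, ∃ w : κ → ℝ,
      rho A ^ 2 * ((v - P *ᵥ w) ⬝ᵥ (v - P *ᵥ w)) ≤ c * (A *ᵥ v ⬝ᵥ A *ᵥ v)) :
    Approximation A P c := by
  intro v
  obtain ⟨w, hw⟩ := h v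
  have hsymm := isSymm_of_posSemidef hA
  have hρ : (rho A)⁻¹ * rho A ^ 2 = rho A := by rw [pow_two, ← mul_assoc, inv_mul_mul_self]
  calc energyNorm A ((1 - coarseCorrection A P) *ᵥ v) ^ 2
      ≤ energyNorm A (v - P *ᵥ w) ^ 2 := energyNorm_one_sub_coarseCorrection_sq_le hA hAc v w
    _ ≤ rho A * ((v - P *ᵥ w) ⬝ᵥ (v - P *ᵥ w)) := by
        rw [energyNorm_sq hA]
        exact dotProduct_mulVec_le_rho hsymm _
    _ = (rho A)⁻¹ * (rho A ^ 2 * ((v - P *ᵥ w) ⬝ᵥ (v - P *ᵥ w))) := by rw [← mul_assoc, hρ]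
    _ ≤ (rho A)⁻¹ * (c * (A *ᵥ v ⬝ᵥ A *ᵥ v)) := by
        gcongr
        exact inv_nonneg.2 (rho_nonneg A)
    _ = c * (rho A)⁻¹ * energyNorm (A ^ 2) v ^ 2 := by
        rw [energyNorm_pow_two_sq hsymm]
        ring

theorem smootherProperty_one {A : Matrix ι ι ℝ} (hA : A.PosDef)
    {𝒢 : (ι → ℝ) → Matrix ι μ ℝ} (h𝒢 : Admissible 𝒢) : SmootherProperty A 𝒢 1 := by
  intro r
  have hB := smoother_posSemidef hA.posSemidef (𝒢 r)
  refine ⟨hB, smoother_mul_mul_smoother A (𝒢 r), ?_⟩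
  rcases eq_or_ne r 0 with rfl | hr
  · simp
  obtain ⟨i, -⟩ := Function.ne_iff.1 hr
  have : Nonempty ι := ⟨i⟩
  obtain ⟨hindep, hrange⟩ := h𝒢 r hr
  rw [one_mul]
  exact dotProduct_self_le_of_mulVec_mulVec_eq hB (smoother_mulVec_mulVec hA hindep hrange)
    (rho_pos hA) (dotProduct_mulVec_le_rho (isSymm_of_posSemidef hA.posSemidef) r)

/-! ### Convergence of the two-grid iteration -/

theorem energyNorm_sq_le_of_one_sub_coarseCorrection_mulVec_eq {A : Matrix ι ι ℝ}
    (hA : A.PosSemidef) {P : Matrix ι κ ℝ} {𝒢 : (ι → ℝ) → Matrix ι μ ℝ} {ca cs : ℝ}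
    (hca : 0 ≤ ca) (hcs : 0 ≤ cs) (happ : Approximation A P ca)
    (hsm : SmootherProperty A 𝒢 cs) {e : ι → ℝ} (he : (1 - coarseCorrection A P) *ᵥ e = e) :
    energyNorm A e ^ 2 ≤ ca * cs * (A *ᵥ e ⬝ᵥ smoother A (𝒢 (A *ᵥ e)) *ᵥ A *ᵥ e) := by
  obtain ⟨hB, -, hres⟩ := hsm (A *ᵥ e)
  have hb : 0 ≤ A *ᵥ e ⬝ᵥ smoother A (𝒢 (A *ᵥ e)) *ᵥ A *ᵥ e := hB.dotProduct_mulVec_nonneg _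
  set b := A *ᵥ e ⬝ᵥ smoother A (𝒢 (A *ᵥ e)) *ᵥ A *ᵥ e
  have hρ : 0 ≤ (rho A)⁻¹ := inv_nonneg.2 (rho_nonneg A)
  have happ_e := happ e
  rw [he, energyNorm_pow_two_sq (isSymm_of_posSemidef hA)] at happ_e
  calc energyNorm A e ^ 2 ≤ ca * (rho A)⁻¹ * (A *ᵥ e ⬝ᵥ A *ᵥ e) := happ_e
    _ ≤ ca * (rho A)⁻¹ * (cs * rho A * b) := by gcongr
    _ = (rho A)⁻¹ * rho A * (ca * cs * b) := by ring
    _ ≤ ca * cs * b := mul_le_of_le_one_left (by positivity) inv_mul_le_one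

theorem exists_ne_zero_one_sub_coarseCorrection_mulVec_eq (A : Matrix ι ι ℝ)
    (P : Matrix ι κ ℝ) (hcard : Fintype.card κ < Fintype.card ι) :
    ∃ e : ι → ℝ, e ≠ 0 ∧ (1 - coarseCorrection A P) *ᵥ e = e := by
  have hker : LinearMap.ker (mulVecLin (Pᵀ * A)) ≠ ⊥ :=
    LinearMap.ker_ne_bot_of_finrank_lt (by simpa using hcard)
  obtain ⟨e, he, he₀⟩ := Submodule.exists_mem_ne_zero_of_ne_bot hker
  rw [LinearMap.mem_ker, mulVecLin_apply] at he
  refine ⟨e, he₀, ?_⟩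
  rw [sub_mulVec, one_mulVec, coarseCorrection, Matrix.mul_assoc, ← mulVec_mulVec, he,
    mulVec_zero, sub_zero]

theorem one_le_mul_of_approximation_of_smootherProperty {A : Matrix ι ι ℝ} (hA : A.PosDef)
    {P : Matrix ι κ ℝ} (hcard : Fintype.card κ < Fintype.card ι)
    {𝒢 : (ι → ℝ) → Matrix ι μ ℝ} {ca cs : ℝ} (hca : 0 ≤ ca) (hcs : 0 ≤ cs)
    (happ : Approximation A P ca) (hsm : SmootherProperty A 𝒢 cs) : 1 ≤ ca * cs := by
  obtain ⟨e, he₀, he⟩ := exists_ne_zero_one_sub_coarseCorrection_mulVec_eq A P hcard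
  have hpos : 0 < energyNorm A e ^ 2 := by
    rw [energyNorm_sq hA.posSemidef]
    exact hA.dotProduct_mulVec_pos he₀
  obtain ⟨hB, hBAB, -⟩ := hsm (A *ᵥ e)
  refine le_of_mul_le_mul_right ?_ hpos
  calc 1 * energyNorm A e ^ 2
      ≤ ca * cs * (A *ᵥ e ⬝ᵥ smoother A (𝒢 (A *ᵥ e)) *ᵥ A *ᵥ e) := by
        rw [one_mul]
        exact energyNorm_sq_le_of_one_sub_coarseCorrection_mulVec_eq hA.posSemidef hca hcs
          happ hsm he
    _ ≤ ca * cs * energyNorm A e ^ 2 := by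
        gcongr
        exact dotProduct_mulVec_mulVec_le_energyNorm_sq hA.posSemidef (isSymm_of_posSemidef hB)
          hBAB e

theorem sub_step_mulVec (A : Matrix ι ι ℝ) (P : Matrix ι κ ℝ) (𝒢 : (ι → ℝ) → Matrix ι μ ℝ)
    (u u' : ι → ℝ) :
    let e := (1 - coarseCorrection A P) *ᵥ (u - u')
    u - step A P 𝒢 (A *ᵥ u) u' = e - smoother A (𝒢 (A *ᵥ e)) *ᵥ A *ᵥ e := by
  intro e
  have hhalf : u - (u' + P *ᵥ (coarseMatrix A P)⁻¹ *ᵥ Pᵀ *ᵥ (A *ᵥ u - A *ᵥ u')) = e := by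
    simp only [e, one_sub_coarseCorrection_mulVec, smoother, coarseMatrix, ← mulVec_sub,
      mulVec_mulVec, Matrix.mul_assoc, sub_sub]
  have hresidual :
      A *ᵥ u - A *ᵥ (u' + P *ᵥ (coarseMatrix A P)⁻¹ *ᵥ Pᵀ *ᵥ (A *ᵥ u - A *ᵥ u')) = A *ᵥ e := by
    rw [← mulVec_sub, hhalf]
  simp only [step, hresidual]
  rw [← sub_sub, hhalf]

theorem energyNorm_sub_step_sq_le {A : Matrix ι ι ℝ} (hA : A.PosSemidef) {P : Matrix ι κ ℝ}
    {𝒢 : (ι → ℝ) → Matrix ι μ ℝ} {ca cs : ℝ} (hca : 0 < ca) (hcs : 0 < cs)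
    (hδ : 0 ≤ 1 - 1 / (ca * cs)) (happ : Approximation A P ca)
    (hsm : SmootherProperty A 𝒢 cs) (u u' : ι → ℝ) :
    energyNorm A (u - step A P 𝒢 (A *ᵥ u) u') ^ 2 ≤
      (1 - 1 / (ca * cs)) * energyNorm A (u - u') ^ 2 := by
  rw [sub_step_mulVec]
  set e := (1 - coarseCorrection A P) *ᵥ (u - u')
  obtain ⟨hB, hBAB, -⟩ := hsm (A *ᵥ e)
  have he : (1 - coarseCorrection A P) *ᵥ e = e := by
    rw [mulVec_mulVec, (isIdempotentElem_coarseCorrection A P).one_sub.eq]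
  have hb := energyNorm_sq_le_of_one_sub_coarseCorrection_mulVec_eq hA hca.le hcs.le happ hsm he
  rw [energyNorm_sub_mulVec_sq hA (isSymm_of_posSemidef hB) hBAB]
  calc energyNorm A e ^ 2 - A *ᵥ e ⬝ᵥ smoother A (𝒢 (A *ᵥ e)) *ᵥ A *ᵥ e
      ≤ energyNorm A e ^ 2 - energyNorm A e ^ 2 / (ca * cs) := by
        gcongr
        exact (div_le_iff₀' (mul_pos hca hcs)).2 hb
    _ = (1 - 1 / (ca * cs)) * energyNorm A e ^ 2 := by ring
    _ ≤ (1 - 1 / (ca * cs)) * energyNorm A (u - u') ^ 2 := by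
        exact mul_le_mul_of_nonneg_left (stability_of_posSemidef hA P (u - u')) hδ

theorem energyNorm_sub_iterates_le {A : Matrix ι ι ℝ} (hA : A.PosSemidef) {P : Matrix ι κ ℝ}
    {𝒢 : (ι → ℝ) → Matrix ι μ ℝ} {ca cs : ℝ} (hca : 0 < ca) (hcs : 0 < cs)
    (hδ : 0 ≤ 1 - 1 / (ca * cs)) (happ : Approximation A P ca)
    (hsm : SmootherProperty A 𝒢 cs) (u u₀ : ι → ℝ) (t : ℕ) :
    energyNorm A (u - iterates A P 𝒢 (A *ᵥ u) u₀ t) ≤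
      (1 - 1 / (ca * cs)) ^ ((t : ℝ) / 2) * energyNorm A (u - u₀) := by
  set δ := 1 - 1 / (ca * cs)
  rw [div_eq_inv_mul, Real.rpow_mul hδ, Real.rpow_natCast, inv_eq_one_div, ← Real.sqrt_eq_rpow]
  induction t with
  | zero => simp [iterates]
  | succ t ih =>
    have hstep : energyNorm A (u - iterates A P 𝒢 (A *ᵥ u) u₀ (t + 1)) ≤
        √δ * energyNorm A (u - iterates A P 𝒢 (A *ᵥ u) u₀ t) := by
      refine le_of_sq_le_sq ?_ (mul_nonneg (Real.sqrt_nonneg _) (energyNorm_nonneg _ _))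
      rw [mul_pow, Real.sq_sqrt hδ]
      exact energyNorm_sub_step_sq_le hA hca hcs hδ happ hsm u _
    calc energyNorm A (u - iterates A P 𝒢 (A *ᵥ u) u₀ (t + 1))
        ≤ √δ * energyNorm A (u - iterates A P 𝒢 (A *ᵥ u) u₀ t) := hstep
      _ ≤ √δ * (√δ ^ t * energyNorm A (u - u₀)) := by gcongr
      _ = √δ ^ (t + 1) * energyNorm A (u - u₀) := by ring

end SubspaceCorrection

/-! ### Difference operators in one dimension -/

section Lap

/-- The forward shift on `Fin n`, with the value past the end replaced by `0`. The difference
operators on a line of interior nodes are polynomials in the shift and its transpose. -/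
noncomputable def shift (n : ℕ) : Matrix (Fin n) (Fin n) ℝ :=
  Matrix.of fun i j => if (i : ℕ) + 1 = j then 1 else 0

/-- The one-dimensional discrete Dirichlet Laplacian `tridiag(-1, 2, -1)`. -/
noncomputable def lap (n : ℕ) : Matrix (Fin n) (Fin n) ℝ := (2 : ℝ) • 1 - shift n - (shift n)ᵀ

/-- Twice the central first difference, `tridiag(-1, 0, 1)`. -/
noncomputable def cdiff (n : ℕ) : Matrix (Fin n) (Fin n) ℝ := shift n - (shift n)ᵀ

/-- The entry of `lap n` as a function of the offset from the row to the column. -/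
noncomputable def lapWeight (d : ℤ) : ℝ := if d = 0 then 2 else if d = 1 ∨ d = -1 then -1 else 0

theorem lap_apply (n : ℕ) (i j : Fin n) : lap n i j = lapWeight ((j : ℤ) - i) := by
  simp only [lap, shift, lapWeight, Matrix.sub_apply, Matrix.smul_apply, Matrix.one_apply,
    transpose_apply, of_apply, Fin.ext_iff, smul_eq_mul]
  split_ifs <;> first | omega | norm_num

theorem lap_isSymm (n : ℕ) : (lap n).IsSymm := by
  simp only [IsSymm, lap, transpose_sub, transpose_smul, transpose_one, transpose_transpose]
  abel

theorem shift_transpose_mul_shift (n : ℕ) :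
    (shift n)ᵀ * shift n = diagonal fun i : Fin n => if (i : ℕ) = 0 then 0 else 1 := by
  ext i j
  simp only [mul_apply, diagonal_apply, shift, transpose_apply, of_apply]
  by_cases hi : (i : ℕ) = 0
  · rw [Finset.sum_eq_zero fun k _ => by rw [if_neg (by omega), zero_mul], if_pos hi, ite_self]
  · rw [Finset.sum_eq_single (⟨i - 1, by omega⟩ : Fin n)]
    · simp only [Fin.ext_iff]
      split_ifs <;> first | omega | norm_num
    · intro k _ hk
      rw [if_neg fun h => hk (Fin.ext (by dsimp only; omega)), zero_mul]
    · exact fun h => absurd (Finset.mem_univ _) h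

theorem one_sub_shift_transpose_mul_shift_posSemidef (n : ℕ) :
    (1 - (shift n)ᵀ * shift n).PosSemidef := by
  rw [shift_transpose_mul_shift, ← diagonal_one, diagonal_sub]
  exact .diagonal fun i => by dsimp only [Pi.zero_apply]; split_ifs <;> norm_num

theorem shift_submatrix_rev (n : ℕ) : (shift n).submatrix Fin.rev Fin.rev = (shift n)ᵀ := by
  ext i j
  simp only [shift, submatrix_apply, transpose_apply, of_apply, Fin.val_rev]
  congr 1
  grind

theorem one_sub_shift_mul_shift_transpose_posSemidef (n : ℕ) :
    (1 - shift n * (shift n)ᵀ).PosSemidef := by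
  have hrev : (1 - (shift n)ᵀ * shift n).submatrix Fin.revPerm Fin.revPerm =
      1 - shift n * (shift n)ᵀ := by
    have hS : (shift n).submatrix Fin.revPerm Fin.revPerm = (shift n)ᵀ := shift_submatrix_rev n
    rw [submatrix_sub, Pi.sub_apply, Pi.sub_apply, submatrix_one_equiv,
      ← submatrix_mul_equiv _ _ _ Fin.revPerm, ← transpose_submatrix, hS, transpose_transpose]
  exact hrev ▸ (one_sub_shift_transpose_mul_shift_posSemidef n).submatrix Fin.revPerm

theorem posSemidef_transpose_mul_self {m n : Type*} [Fintype m] [Finite n] (F : Matrix m n ℝ) :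
    (Fᵀ * F).PosSemidef :=
  posSemidef_conjTranspose_mul_self F

theorem isUnit_one_sub_shift (n : ℕ) : IsUnit (1 - shift n) := by
  rw [isUnit_iff_isUnit_det, det_of_isUpperTriangular]
  · simp [shift]
  · intro i j (hij : j < i)
    rw [Matrix.sub_apply, Matrix.one_apply_ne hij.ne', shift, of_apply, if_neg (by omega),
      sub_zero]

theorem lap_posDef (n : ℕ) : (lap n).PosDef := by
  have h : lap n = (1 - shift n)ᵀ * (1 - shift n) + (1 - (shift n)ᵀ * shift n) := by
    rw [lap, transpose_sub, transpose_one, two_smul]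
    noncomm_ring
  rw [h]
  exact .add_posSemidef (.conjTranspose_mul_self _
    (mulVec_injective_of_isUnit (isUnit_one_sub_shift n)))
    (one_sub_shift_transpose_mul_shift_posSemidef n)

theorem lap_mul_lap_posSemidef (n : ℕ) : (lap n * lap n).PosSemidef := by
  simpa only [(lap_isSymm n).eq] using posSemidef_transpose_mul_self (lap n)

theorem four_sub_lap_posSemidef (n : ℕ) : ((4 : ℝ) • 1 - lap n).PosSemidef := by
  have h : (4 : ℝ) • 1 - lap n =
      (1 + shift n)ᵀ * (1 + shift n) + (1 - (shift n)ᵀ * shift n) := by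
    have hadd : (1 + shift n)ᵀ * (1 + shift n) =
        1 + shift n + (shift n)ᵀ + (shift n)ᵀ * shift n := by
      rw [transpose_add, transpose_one]
      noncomm_ring
    rw [lap, hadd]
    module
  rw [h]
  exact (posSemidef_transpose_mul_self _).add (one_sub_shift_transpose_mul_shift_posSemidef n)

-- The discrete counterpart of `4 (2 - 2 cos θ) = (2 - 2 cos θ) ^ 2 + (2 sin θ) ^ 2`, up to
-- boundary terms.
theorem four_smul_lap_eq (n : ℕ) : (4 : ℝ) • lap n = lap n * lap n + (cdiff n)ᵀ * cdiff n +
    (2 : ℝ) • ((1 - shift n * (shift n)ᵀ) + (1 - (shift n)ᵀ * shift n)) := by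
  simp only [lap, cdiff, transpose_sub, transpose_transpose, two_smul,
    show (4 : ℝ) = 2 * 2 by norm_num, mul_smul]
  noncomm_ring

theorem two_smul_boundary_posSemidef (n : ℕ) :
    ((2 : ℝ) • ((1 - shift n * (shift n)ᵀ) + (1 - (shift n)ᵀ * shift n))).PosSemidef :=
  ((one_sub_shift_mul_shift_transpose_posSemidef n).add
    (one_sub_shift_transpose_mul_shift_posSemidef n)).smul zero_le_two

theorem four_smul_lap_sub_lap_mul_lap_posSemidef (n : ℕ) :
    ((4 : ℝ) • lap n - lap n * lap n).PosSemidef := by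
  rw [four_smul_lap_eq, add_assoc, add_sub_cancel_left]
  exact (posSemidef_transpose_mul_self _).add (two_smul_boundary_posSemidef n)

theorem four_smul_lap_sub_cdiff_transpose_mul_cdiff_posSemidef (n : ℕ) :
    ((4 : ℝ) • lap n - (cdiff n)ᵀ * cdiff n).PosSemidef := by
  rw [four_smul_lap_eq, add_right_comm, add_sub_cancel_right]
  exact (lap_mul_lap_posSemidef n).add (two_smul_boundary_posSemidef n)

end Lap

/-! ### Nine-point operators -/

section NinePoint

open scoped Kronecker

theorem sub_kronecker {l m n p R : Type*} [NonUnitalNonAssocRing R] (A A' : Matrix l m R)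
    (B : Matrix n p R) : (A - A') ⊗ₖ B = A ⊗ₖ B - A' ⊗ₖ B := by
  ext; simp only [kroneckerMap_apply, Matrix.sub_apply, sub_mul]

theorem kronecker_sub {l m n p R : Type*} [NonUnitalNonAssocRing R] (A : Matrix l m R)
    (B B' : Matrix n p R) : A ⊗ₖ (B - B') = A ⊗ₖ B - A ⊗ₖ B' := by
  ext; simp only [kroneckerMap_apply, Matrix.sub_apply, mul_sub]

theorem kronecker_sub_kronecker_posSemidef {m n : Type*} [Finite m] [Finite n]
    {A A' : Matrix m m ℝ} {B B' : Matrix n n ℝ} (hA : (A - A').PosSemidef) (hB : B.PosSemidef)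
    (hA' : A'.PosSemidef) (hB_sub : (B - B').PosSemidef) : (A ⊗ₖ B - A' ⊗ₖ B').PosSemidef := by
  have h : A ⊗ₖ B - A' ⊗ₖ B' = (A - A') ⊗ₖ B + A' ⊗ₖ (B - B') := by
    rw [sub_kronecker, kronecker_sub]
    abel
  rw [h]
  exact (hA.kronecker hB).add (hA'.kronecker hB_sub)

/-- The unscaled five-point discretization of `-Δ`. -/
noncomputable def lap₂ (n : ℕ) : Matrix (Fin n × Fin n) (Fin n × Fin n) ℝ :=
  lap n ⊗ₖ 1 + 1 ⊗ₖ lap n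

/-- The one-parameter family of consistent symmetric nine-point discretizations of `-Δ`, without
the factor `h⁻²`. -/
noncomputable def ninePointMatrix (n : ℕ) (γ : ℝ) : Matrix (Fin n × Fin n) (Fin n × Fin n) ℝ :=
  lap₂ n + γ • (lap n ⊗ₖ lap n)

theorem lap₂_posDef (n : ℕ) : (lap₂ n).PosDef :=
  ((lap_posDef n).kronecker .one).add (PosDef.one.kronecker (lap_posDef n))

theorem lap₂_isSymm (n : ℕ) : (lap₂ n).IsSymm := isSymm_of_posSemidef (lap₂_posDef n).posSemidef

theorem kronecker_lap_posSemidef (n : ℕ) : (lap n ⊗ₖ lap n).PosSemidef :=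
  (lap_posDef n).posSemidef.kronecker (lap_posDef n).posSemidef

theorem eight_sub_lap₂_posSemidef (n : ℕ) : ((8 : ℝ) • 1 - lap₂ n).PosSemidef := by
  have h : (8 : ℝ) • 1 - lap₂ n = ((4 : ℝ) • 1 - lap n) ⊗ₖ 1 + 1 ⊗ₖ ((4 : ℝ) • 1 - lap n) := by
    rw [lap₂, sub_kronecker, kronecker_sub, smul_kronecker, kronecker_smul, one_kronecker_one]
    module
  rw [h]
  exact ((four_sub_lap_posSemidef n).kronecker .one).add
    (PosSemidef.one.kronecker (four_sub_lap_posSemidef n))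

theorem two_smul_lap₂_sub_kronecker_lap (n : ℕ) : (2 : ℝ) • lap₂ n - lap n ⊗ₖ lap n =
    (1 / 2 : ℝ) • (lap n ⊗ₖ ((4 : ℝ) • 1 - lap n) + ((4 : ℝ) • 1 - lap n) ⊗ₖ lap n) := by
  rw [lap₂, sub_kronecker, kronecker_sub, smul_kronecker, kronecker_smul]
  module

theorem two_smul_lap₂_sub_kronecker_lap_posSemidef (n : ℕ) :
    ((2 : ℝ) • lap₂ n - lap n ⊗ₖ lap n).PosSemidef := by
  have hL := (lap_posDef n).posSemidef
  have hL' := four_sub_lap_posSemidef n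
  rw [two_smul_lap₂_sub_kronecker_lap]
  exact ((hL.kronecker hL').add (hL'.kronecker hL)).smul (by norm_num)

theorem lap₂_mul_kronecker_posSemidef {n : ℕ} {X Y : Matrix (Fin n) (Fin n) ℝ}
    (hX : X.PosSemidef) (hY : Y.PosSemidef) (hLX : (lap n * X).PosSemidef)
    (hLY : (lap n * Y).PosSemidef) : (lap₂ n * (X ⊗ₖ Y)).PosSemidef := by
  rw [lap₂, Matrix.add_mul, ← mul_kronecker_mul, ← mul_kronecker_mul, Matrix.one_mul,
    Matrix.one_mul]
  exact (hLX.kronecker hY).add (hX.kronecker hLY)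

theorem lap₂_mul_kronecker_lap_posSemidef (n : ℕ) : (lap₂ n * (lap n ⊗ₖ lap n)).PosSemidef :=
  have hL := (lap_posDef n).posSemidef
  lap₂_mul_kronecker_posSemidef hL hL (lap_mul_lap_posSemidef n) (lap_mul_lap_posSemidef n)

theorem lap₂_mul_two_smul_lap₂_sub_kronecker_lap_posSemidef (n : ℕ) :
    (lap₂ n * ((2 : ℝ) • lap₂ n - lap n ⊗ₖ lap n)).PosSemidef := by
  have hL := (lap_posDef n).posSemidef
  have hL' := four_sub_lap_posSemidef n
  have hLL := lap_mul_lap_posSemidef n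
  have hLL' : (lap n * ((4 : ℝ) • 1 - lap n)).PosSemidef := by
    rw [Matrix.mul_sub, Matrix.mul_smul, Matrix.mul_one]
    exact four_smul_lap_sub_lap_mul_lap_posSemidef n
  rw [two_smul_lap₂_sub_kronecker_lap, Matrix.mul_smul, Matrix.mul_add]
  exact ((lap₂_mul_kronecker_posSemidef hL hL' hLL hLL').add
    (lap₂_mul_kronecker_posSemidef hL' hL hLL' hLL)).smul (by norm_num)

/-- The positive semidefinite matrix by which `ninePointMatrix n γ` exceeds a multiple of the
five-point operator. For `γ < 0` it rests on `lap n ⊗ₖ lap n` being at most twice `lap₂ n`. -/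
noncomputable def ninePointRemainder (n : ℕ) (γ : ℝ) :
    Matrix (Fin n × Fin n) (Fin n × Fin n) ℝ :=
  γ⁺ • (lap n ⊗ₖ lap n) + γ⁻ • ((2 : ℝ) • lap₂ n - lap n ⊗ₖ lap n)

theorem ninePointMatrix_eq (n : ℕ) (γ : ℝ) :
    ninePointMatrix n γ = (1 - 2 * γ⁻) • lap₂ n + ninePointRemainder n γ := by
  nth_rw 1 [ninePointMatrix, ninePointRemainder, ← posPart_sub_negPart γ]
  module

theorem ninePointRemainder_posSemidef (n : ℕ) (γ : ℝ) : (ninePointRemainder n γ).PosSemidef :=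
  ((kronecker_lap_posSemidef n).smul (posPart_nonneg γ)).add
    ((two_smul_lap₂_sub_kronecker_lap_posSemidef n).smul (negPart_nonneg γ))

theorem lap₂_mul_ninePointRemainder_posSemidef (n : ℕ) (γ : ℝ) :
    (lap₂ n * ninePointRemainder n γ).PosSemidef := by
  rw [ninePointRemainder, Matrix.mul_add, Matrix.mul_smul, Matrix.mul_smul]
  exact ((lap₂_mul_kronecker_lap_posSemidef n).smul (posPart_nonneg γ)).add
    ((lap₂_mul_two_smul_lap₂_sub_kronecker_lap_posSemidef n).smul (negPart_nonneg γ))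

theorem one_sub_two_mul_negPart_pos {γ : ℝ} (hγ : -(1 / 2) < γ) : 0 < 1 - 2 * γ⁻ := by
  rw [negPart_def]
  rcases max_cases (-γ) 0 with h | h <;> linarith

theorem ninePointMatrix_posDef (n : ℕ) {γ : ℝ} (hγ : -(1 / 2) < γ) :
    (ninePointMatrix n γ).PosDef := by
  rw [ninePointMatrix_eq]
  exact ((lap₂_posDef n).smul (one_sub_two_mul_negPart_pos hγ)).add_posSemidef
    (ninePointRemainder_posSemidef n γ)

theorem smul_one_sub_ninePointMatrix_posSemidef (n : ℕ) (γ : ℝ) :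
    ((8 * (1 + 2 * |γ|)) • 1 - ninePointMatrix n γ).PosSemidef := by
  have h : (8 * (1 + 2 * |γ|)) • 1 - ninePointMatrix n γ =
      (1 + 2 * |γ|) • ((8 : ℝ) • 1 - lap₂ n) + |γ| • ((2 : ℝ) • lap₂ n - lap n ⊗ₖ lap n) +
        (|γ| - γ) • (lap n ⊗ₖ lap n) := by
    rw [ninePointMatrix]
    module
  rw [h]
  exact (((eight_sub_lap₂_posSemidef n).smul (by positivity)).add
    ((two_smul_lap₂_sub_kronecker_lap_posSemidef n).smul (abs_nonneg γ))).add
    ((kronecker_lap_posSemidef n).smul (sub_nonneg.2 (le_abs_self γ)))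

theorem sq_mul_dotProduct_mulVec_self_le {ι : Type} [Fintype ι] {S Q : Matrix ι ι ℝ}
    (hS : S.IsSymm) (hSQ : (S * Q).PosSemidef) {a : ℝ} (ha : 0 ≤ a) (v : ι → ℝ) :
    a ^ 2 * (S *ᵥ v ⬝ᵥ S *ᵥ v) ≤ (a • S + Q) *ᵥ v ⬝ᵥ (a • S + Q) *ᵥ v := by
  have hcross : S *ᵥ v ⬝ᵥ Q *ᵥ v = v ⬝ᵥ (S * Q) *ᵥ v := by
    rw [← mulVec_mulVec, dotProduct_mulVec_comm hS, dotProduct_comm]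
  have hexpand : (a • S + Q) *ᵥ v ⬝ᵥ (a • S + Q) *ᵥ v = a ^ 2 * (S *ᵥ v ⬝ᵥ S *ᵥ v) +
      2 * a * (v ⬝ᵥ (S * Q) *ᵥ v) + Q *ᵥ v ⬝ᵥ Q *ᵥ v := by
    simp only [add_mulVec, smul_mulVec, dotProduct_add, add_dotProduct, smul_dotProduct,
      dotProduct_smul, smul_eq_mul, dotProduct_comm (Q *ᵥ v) (S *ᵥ v), hcross]
    ring
  have hSQv : 0 ≤ v ⬝ᵥ (S * Q) *ᵥ v := hSQ.dotProduct_mulVec_nonneg v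
  have hQv : 0 ≤ Q *ᵥ v ⬝ᵥ Q *ᵥ v := dotProduct_star_self_nonneg (Q *ᵥ v)
  rw [hexpand, add_assoc]
  exact le_add_of_nonneg_right (by positivity)

theorem sq_mul_lap₂_le_ninePointMatrix {n : ℕ} {γ : ℝ} (hγ : -(1 / 2) < γ)
    (v : Fin n × Fin n → ℝ) : (1 - 2 * γ⁻) ^ 2 * (lap₂ n *ᵥ v ⬝ᵥ lap₂ n *ᵥ v) ≤
      ninePointMatrix n γ *ᵥ v ⬝ᵥ ninePointMatrix n γ *ᵥ v := by
  rw [ninePointMatrix_eq]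
  exact sq_mul_dotProduct_mulVec_self_le (lap₂_isSymm n)
    (lap₂_mul_ninePointRemainder_posSemidef n γ) (one_sub_two_mul_negPart_pos hγ).le v

theorem kronecker_self_le {n : ℕ} {F : Matrix (Fin n) (Fin n) ℝ}
    (hF : ((4 : ℝ) • lap n - Fᵀ * F).PosSemidef) (v : Fin n × Fin n → ℝ) :
    (F ⊗ₖ F) *ᵥ v ⬝ᵥ (F ⊗ₖ F) *ᵥ v ≤ 16 * (v ⬝ᵥ (lap n ⊗ₖ lap n) *ᵥ v) := by
  have hsub : (((4 : ℝ) • lap n) ⊗ₖ ((4 : ℝ) • lap n) - (Fᵀ * F) ⊗ₖ (Fᵀ * F)).PosSemidef :=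
    kronecker_sub_kronecker_posSemidef hF ((lap_posDef n).posSemidef.smul zero_le_four)
      (posSemidef_transpose_mul_self F) hF
  have hquad : 0 ≤ v ⬝ᵥ (((4 : ℝ) • lap n) ⊗ₖ ((4 : ℝ) • lap n) - (Fᵀ * F) ⊗ₖ (Fᵀ * F)) *ᵥ v :=
    hsub.dotProduct_mulVec_nonneg v
  have hF₂ : v ⬝ᵥ ((Fᵀ * F) ⊗ₖ (Fᵀ * F)) *ᵥ v = (F ⊗ₖ F) *ᵥ v ⬝ᵥ (F ⊗ₖ F) *ᵥ v := by
    rw [mul_kronecker_mul, kroneckerMap_transpose, ← mulVec_mulVec, dotProduct_transpose_mulVec,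
      dotProduct_comm]
  rw [sub_mulVec, dotProduct_sub, hF₂, smul_kronecker, kronecker_smul, smul_smul, smul_mulVec,
    dotProduct_smul, smul_eq_mul] at hquad
  linarith

theorem lap₂_mulVec_dotProduct_self (n : ℕ) (v : Fin n × Fin n → ℝ) :
    lap₂ n *ᵥ v ⬝ᵥ lap₂ n *ᵥ v =
      (lap n ⊗ₖ (1 : Matrix (Fin n) (Fin n) ℝ)) *ᵥ v ⬝ᵥ (lap n ⊗ₖ 1) *ᵥ v +
        ((1 : Matrix (Fin n) (Fin n) ℝ) ⊗ₖ lap n) *ᵥ v ⬝ᵥ (1 ⊗ₖ lap n) *ᵥ v +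
        2 * (v ⬝ᵥ (lap n ⊗ₖ lap n) *ᵥ v) := by
  have hcross : (lap n ⊗ₖ (1 : Matrix (Fin n) (Fin n) ℝ)) *ᵥ v ⬝ᵥ (1 ⊗ₖ lap n) *ᵥ v =
      v ⬝ᵥ (lap n ⊗ₖ lap n) *ᵥ v := by
    rw [dotProduct_comm, ← dotProduct_transpose_mulVec, ← kroneckerMap_transpose,
      (lap_isSymm n).eq, transpose_one, mulVec_mulVec, ← mul_kronecker_mul, Matrix.one_mul,
      Matrix.mul_one]
  rw [lap₂, add_mulVec, dotProduct_add, add_dotProduct, add_dotProduct,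
    dotProduct_comm ((1 ⊗ₖ lap n) *ᵥ v) ((lap n ⊗ₖ 1) *ᵥ v), hcross]
  ring

end NinePoint

/-! ### Interpolation error -/

section Interpolation

open scoped Kronecker

/-- The one-dimensional prolongation with stencil `f`: its entries are `f (x - 2 y)` in terms of the
integer coordinates `x = i + 1` and `y = q + 1` of the nodes. -/
noncomputable def lineProlongation (f : ℤ → ℝ) (M : ℕ) :
    Matrix (Fin (2 * M - 1)) (Fin (M - 1)) ℝ :=
  Matrix.of fun i q => f ((i : ℤ) + 1 - 2 * ((q : ℤ) + 1))

/-- The index on a fine line of the coarse node `q`. Fine nodes with an even index, i.e. an odd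
coordinate, are not of this form. -/
def coarseIndex {M : ℕ} (q : Fin (M - 1)) : Fin (2 * M - 1) := ⟨2 * q + 1, by omega⟩

/-- The injection of fine grid functions to the coarse grid: the values at the coarse nodes. -/
noncomputable def injection (M : ℕ) : Matrix (Fin (M - 1)) (Fin (2 * M - 1)) ℝ :=
  (1 : Matrix (Fin (2 * M - 1)) (Fin (2 * M - 1)) ℝ).submatrix coarseIndex id

/-- The stencil of piecewise linear interpolation. -/
noncomputable def linWeight (d : ℤ) : ℝ :=
  if d = 0 then 1 else if d = 1 ∨ d = -1 then 1 / 2 else 0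

/-- The odd stencil whose tensor square accounts for the diagonal of the seven-point
prolongation. -/
noncomputable def oddWeight (d : ℤ) : ℝ := if d = 1 then 1 else if d = -1 then -1 else 0

/-- Half the indicator function of the fine nodes that are not coarse nodes. -/
noncomputable def nonCoarseHalf (M : ℕ) (i : Fin (2 * M - 1)) : ℝ :=
  if Even (i : ℕ) then 1 / 2 else 0

theorem abs_nonCoarseHalf_le_one {M : ℕ} (i : Fin (2 * M - 1)) : |nonCoarseHalf M i| ≤ 1 := by
  rw [nonCoarseHalf]
  split_ifs <;> norm_num [abs_of_pos]

theorem lineProlongation_mul_injection_apply (f : ℤ → ℝ) (M : ℕ) (i j : Fin (2 * M - 1)) :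
    (lineProlongation f M * injection M) i j = if Even (j : ℕ) then 0 else f ((i : ℤ) - j) := by
  simp only [mul_apply, lineProlongation, injection, submatrix_apply, of_apply, id_eq,
    Matrix.one_apply, mul_ite, mul_one, mul_zero]
  split_ifs with hj
  · obtain ⟨k, hk⟩ := hj
    exact Finset.sum_eq_zero fun q _ => if_neg fun h => by
      have := congrArg Fin.val h
      simp only [coarseIndex] at this
      omega
  · obtain ⟨k, hk⟩ := Nat.not_even_iff_odd.1 hj
    have hcoarse : ∀ q : Fin (M - 1), coarseIndex q = j ↔ q = ⟨k, by omega⟩ := fun q => by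
      simp only [coarseIndex, Fin.ext_iff]
      omega
    simp only [hcoarse, Finset.sum_ite_eq', Finset.mem_univ, if_true]
    congr 1
    omega

theorem injection_mul_lineProlongation_apply (f : ℤ → ℝ) (M : ℕ) (q q' : Fin (M - 1)) :
    (injection M * lineProlongation f M) q q' = f (2 * ((q : ℤ) - q')) := by
  rw [injection, ← Equiv.coe_refl, one_submatrix_mul, submatrix_apply, lineProlongation, of_apply]
  congr 1
  simp only [coarseIndex, Function.comp_apply, Equiv.refl_symm, Equiv.refl_apply, id_eq]
  push_cast
  ring

theorem lineProlongation_linWeight_mul_injection (M : ℕ) :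
    lineProlongation linWeight M * injection M =
      1 - diagonal (nonCoarseHalf M) * lap (2 * M - 1) := by
  ext i j
  rw [lineProlongation_mul_injection_apply, Matrix.sub_apply, diagonal_mul, lap_apply,
    Matrix.one_apply]
  simp only [Fin.ext_iff, linWeight, lapWeight, nonCoarseHalf, Nat.even_iff]
  split_ifs <;> first | omega | norm_num

theorem lineProlongation_oddWeight_mul_injection (M : ℕ) :
    lineProlongation oddWeight M * injection M =
      (-2 : ℝ) • (diagonal (nonCoarseHalf M) * cdiff (2 * M - 1)) := by
  ext i j
  rw [lineProlongation_mul_injection_apply, Matrix.smul_apply, diagonal_mul]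
  simp only [cdiff, shift, Matrix.sub_apply, transpose_apply, of_apply, oddWeight, nonCoarseHalf,
    Nat.even_iff, smul_eq_mul]
  split_ifs <;> first | omega | norm_num

theorem injection_mul_lineProlongation_linWeight (M : ℕ) :
    injection M * lineProlongation linWeight M = 1 := by
  ext q q'
  rw [injection_mul_lineProlongation_apply, Matrix.one_apply]
  simp only [linWeight, Fin.ext_iff]
  split_ifs <;> first | omega | norm_num

theorem injection_mul_lineProlongation_oddWeight (M : ℕ) :
    injection M * lineProlongation oddWeight M = 0 := by
  ext q q'
  rw [injection_mul_lineProlongation_apply, Matrix.zero_apply]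
  simp only [oddWeight]
  split_ifs <;> first | omega | norm_num

/-- The multiple (up to a factor `4`) of the odd tensor stencil by which a prolongation differs
from bilinear interpolation. -/
noncomputable def Prolongation.oddCoeff : Prolongation → ℝ
  | .sevenPoint => 1
  | .ninePoint => 0

theorem Prolongation.oddCoeff_sq_le_one (π : Prolongation) : π.oddCoeff ^ 2 ≤ 1 := by
  cases π <;> norm_num [Prolongation.oddCoeff]

theorem Prolongation.stencil_eq (π : Prolongation) (a b : ℤ) : π.stencil a b =
    linWeight a * linWeight b + π.oddCoeff / 4 * (oddWeight a * oddWeight b) := by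
  cases π <;>
    simp only [Prolongation.stencil, Prolongation.oddCoeff, linWeight, oddWeight] <;>
    split_ifs <;> first | omega | grind

theorem Prolongation.matrix_eq (π : Prolongation) (M : ℕ) : π.matrix M =
    lineProlongation linWeight M ⊗ₖ lineProlongation linWeight M +
      (π.oddCoeff / 4) • (lineProlongation oddWeight M ⊗ₖ lineProlongation oddWeight M) := by
  ext p q
  exact π.stencil_eq _ _

theorem injection_mul_prolongation (π : Prolongation) (M : ℕ) :
    (injection M ⊗ₖ injection M) * π.matrix M = 1 := by
  rw [π.matrix_eq, Matrix.mul_add, Matrix.mul_smul, ← mul_kronecker_mul, ← mul_kronecker_mul,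
    injection_mul_lineProlongation_linWeight, injection_mul_lineProlongation_oddWeight,
    zero_kronecker, smul_zero, add_zero, one_kronecker_one]

theorem prolongation_injective (π : Prolongation) (M : ℕ) :
    Function.Injective (π.matrix M).mulVec :=
  Function.LeftInverse.injective (g := (injection M ⊗ₖ injection M).mulVec) fun v => by
    rw [mulVec_mulVec, injection_mul_prolongation, one_mulVec]

theorem one_sub_prolongation_mul_injection (π : Prolongation) (M : ℕ) :
    1 - π.matrix M * (injection M ⊗ₖ injection M) =
      (diagonal (nonCoarseHalf M) * lap (2 * M - 1)) ⊗ₖ 1 +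
        1 ⊗ₖ (diagonal (nonCoarseHalf M) * lap (2 * M - 1)) -
        (diagonal (nonCoarseHalf M) * lap (2 * M - 1)) ⊗ₖ
          (diagonal (nonCoarseHalf M) * lap (2 * M - 1)) -
        π.oddCoeff • ((diagonal (nonCoarseHalf M) * cdiff (2 * M - 1)) ⊗ₖ
          (diagonal (nonCoarseHalf M) * cdiff (2 * M - 1))) := by
  rw [π.matrix_eq, Matrix.add_mul, smul_mul, ← mul_kronecker_mul, ← mul_kronecker_mul,
    lineProlongation_linWeight_mul_injection, lineProlongation_oddWeight_mul_injection,
    sub_kronecker, kronecker_sub, kronecker_sub, smul_kronecker, kronecker_smul,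
    one_kronecker_one]
  module

theorem diagonal_mulVec_dotProduct_self_le {ι : Type*} [Fintype ι] [DecidableEq ι] {d : ι → ℝ}
    (hd : ∀ i, |d i| ≤ 1) (v : ι → ℝ) : diagonal d *ᵥ v ⬝ᵥ diagonal d *ᵥ v ≤ v ⬝ᵥ v := by
  refine Finset.sum_le_sum fun i _ => ?_
  rw [mulVec_diagonal, mul_mul_mul_comm, ← sq]
  exact mul_le_of_le_one_left (mul_self_nonneg _) ((sq_le_one_iff_abs_le_one _).2 (hd i))

theorem kronecker_diagonal_mul_mulVec_dotProduct_self_le {m n m' n' : Type*} [Fintype m]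
    [Fintype n] [Fintype m'] [Fintype n'] [DecidableEq m] [DecidableEq n] {a : m → ℝ} {b : n → ℝ}
    (ha : ∀ i, |a i| ≤ 1) (hb : ∀ j, |b j| ≤ 1) (X : Matrix m m' ℝ) (Y : Matrix n n' ℝ)
    (v : m' × n' → ℝ) :
    ((diagonal a * X) ⊗ₖ (diagonal b * Y)) *ᵥ v ⬝ᵥ ((diagonal a * X) ⊗ₖ (diagonal b * Y)) *ᵥ v ≤
      (X ⊗ₖ Y) *ᵥ v ⬝ᵥ (X ⊗ₖ Y) *ᵥ v := by
  rw [mul_kronecker_mul, diagonal_kronecker_diagonal, ← mulVec_mulVec]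
  refine diagonal_mulVec_dotProduct_self_le (fun p => ?_) _
  rw [abs_mul]
  exact mul_le_one₀ (ha p.1) (abs_nonneg _) (hb p.2)

theorem add_sub_sub_dotProduct_self_le {ι : Type*} [Fintype ι] (a b c d : ι → ℝ) :
    (a + b - c - d) ⬝ᵥ (a + b - c - d) ≤ 4 * (a ⬝ᵥ a + b ⬝ᵥ b + c ⬝ᵥ c + d ⬝ᵥ d) := by
  simp only [dotProduct, ← Finset.sum_add_distrib, Finset.mul_sum, Pi.add_apply, Pi.sub_apply]
  refine Finset.sum_le_sum fun i _ => ?_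
  linarith [sq_nonneg (a i - b i), sq_nonneg (a i + c i), sq_nonneg (a i + d i),
    sq_nonneg (b i + c i), sq_nonneg (b i + d i), sq_nonneg (c i - d i)]

theorem interpolation_error_le (π : Prolongation) (M : ℕ) (v : Node (2 * M) → ℝ) :
    (v - π.matrix M *ᵥ (injection M ⊗ₖ injection M) *ᵥ v) ⬝ᵥ
        (v - π.matrix M *ᵥ (injection M ⊗ₖ injection M) *ᵥ v) ≤
      64 * (lap₂ (2 * M - 1) *ᵥ v ⬝ᵥ lap₂ (2 * M - 1) *ᵥ v) := by
  set n := 2 * M - 1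
  set t := nonCoarseHalf M
  have ht : ∀ i, |t i| ≤ 1 := abs_nonCoarseHalf_le_one
  have hone : ∀ i : Fin n, |(1 : Fin n → ℝ) i| ≤ 1 := fun _ => abs_one.le
  have hx := kronecker_diagonal_mul_mulVec_dotProduct_self_le ht hone (lap n) 1 v
  have hy := kronecker_diagonal_mul_mulVec_dotProduct_self_le hone ht 1 (lap n) v
  have hxy := (kronecker_diagonal_mul_mulVec_dotProduct_self_le ht ht (lap n) (lap n) v).trans
    (kronecker_self_le (by
      rw [(lap_isSymm n).eq]; exact four_smul_lap_sub_lap_mul_lap_posSemidef n) v)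
  have hodd := (kronecker_diagonal_mul_mulVec_dotProduct_self_le ht ht (cdiff n) (cdiff n) v).trans
    (kronecker_self_le (four_smul_lap_sub_cdiff_transpose_mul_cdiff_posSemidef n) v)
  rw [show diagonal (1 : Fin n → ℝ) = 1 from diagonal_one, Matrix.one_mul] at hx hy
  have herror : v - π.matrix M *ᵥ (injection M ⊗ₖ injection M) *ᵥ v =
      ((diagonal t * lap n) ⊗ₖ 1) *ᵥ v + (1 ⊗ₖ (diagonal t * lap n)) *ᵥ v -
        ((diagonal t * lap n) ⊗ₖ (diagonal t * lap n)) *ᵥ v -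
        π.oddCoeff • ((diagonal t * cdiff n) ⊗ₖ (diagonal t * cdiff n)) *ᵥ v := by
    rw [mulVec_mulVec, ← smul_mulVec, ← add_mulVec, ← sub_mulVec, ← sub_mulVec,
      ← one_sub_prolongation_mul_injection, sub_mulVec, one_mulVec]
  rw [herror, lap₂_mulVec_dotProduct_self]
  refine (add_sub_sub_dotProduct_self_le _ _ _ _).trans ?_
  rw [smul_dotProduct, dotProduct_smul, smul_smul, smul_eq_mul, ← sq]
  have hcoeff := mul_le_of_le_one_left (dotProduct_star_self_nonneg
    (((diagonal t * cdiff n) ⊗ₖ (diagonal t * cdiff n)) *ᵥ v)) π.oddCoeff_sq_le_one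
  have hnonneg := dotProduct_star_self_nonneg ((lap n ⊗ₖ (1 : Matrix (Fin n) (Fin n) ℝ)) *ᵥ v)
  have hnonneg' := dotProduct_star_self_nonneg (((1 : Matrix (Fin n) (Fin n) ℝ) ⊗ₖ lap n) *ᵥ v)
  simp only [star_trivial] at hcoeff hnonneg hnonneg'
  linarith

theorem approximation_smul_ninePointMatrix {γ s : ℝ} (hγ : -(1 / 2) < γ) (hs : 0 < s)
    (π : Prolongation) (M : ℕ) : Approximation (s • ninePointMatrix (2 * M - 1) γ) (π.matrix M)
      ((64 * (1 + 2 * |γ|) / (1 - 2 * γ⁻)) ^ 2) := by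
  set B := ninePointMatrix (2 * M - 1) γ
  set S := lap₂ (2 * M - 1)
  have hα := one_sub_two_mul_negPart_pos hγ
  set α := 1 - 2 * γ⁻
  have hA : (s • B).PosDef := (ninePointMatrix_posDef _ hγ).smul hs
  have hρ : rho (s • B) ≤ s * (8 * (1 + 2 * |γ|)) := by
    refine rho_le_of_posSemidef (by positivity) hA.posSemidef ?_
    have := (smul_one_sub_ninePointMatrix_posSemidef (2 * M - 1) γ).smul hs.le
    rwa [smul_sub, smul_smul] at this
  refine approximation_of_forall_exists hA.posSemidef
    (coarseMatrix_posDef hA (prolongation_injective π M)).isUnit fun v =>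
      ⟨(injection M ⊗ₖ injection M) *ᵥ v, ?_⟩
  set e := v - π.matrix M *ᵥ (injection M ⊗ₖ injection M) *ᵥ v
  have hlower : α ^ 2 * (S *ᵥ v ⬝ᵥ S *ᵥ v) ≤ B *ᵥ v ⬝ᵥ B *ᵥ v :=
    sq_mul_lap₂_le_ninePointMatrix hγ v
  calc rho (s • B) ^ 2 * (e ⬝ᵥ e)
      ≤ (s * (8 * (1 + 2 * |γ|))) ^ 2 * (64 * (S *ᵥ v ⬝ᵥ S *ᵥ v)) := by
        gcongr
        · exact dotProduct_star_self_nonneg e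
        · exact rho_nonneg _
        · exact interpolation_error_le π M v
    _ = (64 * (1 + 2 * |γ|) / α) ^ 2 * (s ^ 2 * (α ^ 2 * (S *ᵥ v ⬝ᵥ S *ᵥ v))) := by
        field_simp
        ring
    _ ≤ (64 * (1 + 2 * |γ|) / α) ^ 2 * (s ^ 2 * (B *ᵥ v ⬝ᵥ B *ᵥ v)) := by gcongr
    _ = _ := by
        rw [smul_mulVec, smul_dotProduct, dotProduct_smul, smul_eq_mul, smul_eq_mul]
        ring

end Interpolation

/-! ### Finite difference schemes -/

/-- The stencil of `ninePointMatrix`: the five-point stencil plus `γ` times the tensor product of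
two second differences. -/
noncomputable def ninePointStencil (γ : ℝ) (a b : ℤ) : ℝ :=
  lapWeight a * (if b = 0 then 1 else 0) + (if a = 0 then 1 else 0) * lapWeight b +
    γ * (lapWeight a * lapWeight b)

theorem ninePointMatrix_apply {N : ℕ} (γ : ℝ) (p q : Node N) :
    ninePointMatrix (N - 1) γ p q = ninePointStencil γ (xc q - xc p) (yc q - yc p) := by
  have hone : ∀ i j : Fin (N - 1), (1 : Matrix (Fin (N - 1)) (Fin (N - 1)) ℝ) i j =
      if (j : ℤ) - i = 0 then 1 else 0 := fun i j => by
    simp only [one_apply, Fin.ext_iff]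
    split_ifs <;> first | omega | rfl
  simp only [ninePointMatrix, lap₂, ninePointStencil, xc, yc, add_sub_add_right_eq_sub,
    Matrix.add_apply, Matrix.smul_apply, kroneckerMap_apply, lap_apply, hone, smul_eq_mul]

theorem sum_Icc_neg_one_one {E : Type*} [AddCommMonoid E] (f : ℤ → E) :
    ∑ a ∈ Finset.Icc (-1 : ℤ) 1, f a = f (-1) + (f 0 + f 1) := by
  rw [show Finset.Icc (-1 : ℤ) 1 = {-1, 0, 1} by decide, Finset.sum_insert (by decide),
    Finset.sum_pair (by decide)]

namespace IsPoissonStencil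

variable {K : ℤ → ℤ → ℝ}

-- The moments up to order two leave only the coefficient of the mixed fourth difference free.
theorem eq_ninePointStencil (hK : IsPoissonStencil K) (a b : ℤ) :
    K a b = ninePointStencil (K 1 1) a b := by
  have hcorner : K (-1) (-1) = K 1 1 := hK.symm 1 1
  have hanti : K (-1) 1 = K 1 (-1) := by simpa only [neg_neg] using hK.symm 1 (-1)
  have hleft : K (-1) 0 = K 1 0 := hK.symm 1 0
  have hbottom : K 0 (-1) = K 0 1 := hK.symm 0 1
  have hzero := hK.moment_zero
  have hxx := hK.moment_xx
  have hyy := hK.moment_yy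
  have hxy := hK.moment_xy
  simp only [sum_Icc_neg_one_one, hcorner, hanti, hleft, hbottom] at hzero hxx hyy hxy
  norm_num at hzero hxx hyy hxy
  have hanti' : K 1 (-1) = K 1 1 := by linarith
  have hright : K 1 0 = -1 - 2 * K 1 1 := by linarith
  have htop : K 0 1 = -1 - 2 * K 1 1 := by linarith
  have hcenter : K 0 0 = 4 + 4 * K 1 1 := by linarith
  by_cases hab : 1 < |a| ∨ 1 < |b|
  · rw [hK.support a b hab]
    simp only [lt_abs] at hab
    simp only [ninePointStencil, lapWeight]
    split_ifs <;> first | omega | simp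
  · simp only [lt_abs] at hab
    have ha : a = -1 ∨ a = 0 ∨ a = 1 := by omega
    have hb : b = -1 ∨ b = 0 ∨ b = 1 := by omega
    rcases ha with rfl | rfl | rfl <;> rcases hb with rfl | rfl | rfl <;>
      simp only [ninePointStencil, lapWeight, hcorner, hanti, hleft, hbottom, hanti', hright,
        htop, hcenter] <;> norm_num <;> ring

-- The symbol of the stencil at the frequency `(π, π)` is `8 + 16 K(1, 1)`.
theorem neg_half_lt (hK : IsPoissonStencil K) : -(1 / 2) < K 1 1 := by
  have hπ : Real.pi ∈ Set.Ioc (-Real.pi) Real.pi := ⟨by linarith [Real.pi_pos], le_rfl⟩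
  have helliptic := hK.elliptic _ hπ _ hπ (Or.inl Real.pi_ne_zero)
  have hcos : Real.cos (Real.pi + Real.pi) = 1 := by rw [← two_mul, Real.cos_two_pi]
  have hcos' : Real.cos (-Real.pi + -Real.pi) = 1 := by rw [← neg_add, Real.cos_neg, hcos]
  simp only [sum_Icc_neg_one_one, hK.eq_ninePointStencil (-1), hK.eq_ninePointStencil 0,
    hK.eq_ninePointStencil 1 (-1), hK.eq_ninePointStencil 1 0, ninePointStencil,
    lapWeight] at helliptic
  norm_num [hcos, hcos'] at helliptic
  linarith

theorem fdmMatrix_eq (hK : IsPoissonStencil K) (N : ℕ) :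
    fdmMatrix N K = (N : ℝ) ^ 2 • ninePointMatrix (N - 1) (K 1 1) := by
  ext p q
  rw [Matrix.smul_apply, ninePointMatrix_apply, fdmMatrix, of_apply, hK.eq_ninePointStencil,
    smul_eq_mul]

end IsPoissonStencil

/-! ### Stiffness matrices -/

section Stiffness

open MeasureTheory Set

theorem ae_mul_sub_notMem_range_intCast {c : ℝ} (hc : c ≠ 0) (d : ℝ) :
    ∀ᵐ s : ℝ, c * s - d ∉ range ((↑) : ℤ → ℝ) :=
  ((countable_range _).preimage fun _ _ h => mul_left_cancel₀ hc (sub_left_injective h)).ae_notMem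
    volume

theorem sub_intCast_notMem_range {x : ℝ} (k : ℤ) (hx : x ∉ range ((↑) : ℤ → ℝ)) :
    x - k ∉ range ((↑) : ℤ → ℝ) := by
  rintro ⟨m, hm⟩
  exact hx ⟨m + k, by rw [Int.cast_add, hm, sub_add_cancel]⟩

theorem neg_notMem_range_intCast {x : ℝ} (hx : x ∉ range ((↑) : ℤ → ℝ)) :
    -x ∉ range ((↑) : ℤ → ℝ) := by
  rintro ⟨m, hm⟩
  exact hx ⟨-m, by rw [Int.cast_neg, hm, neg_neg]⟩

/-- `g` is the slope of the reference hat function `hat` in its first variable, away from the lines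
`s ∈ ℤ`, `t ∈ ℤ` and `s - t ∈ ℤ` of the triangulated unit grid. By symmetry of `hat` the slope in
the second variable is `g t s`. -/
structure IsSlope (hat g : ℝ → ℝ → ℝ) : Prop where
  symm : ∀ s t, hat s t = hat t s
  hasDerivAt : ∀ s t, s ∉ range ((↑) : ℤ → ℝ) → t ∉ range ((↑) : ℤ → ℝ) →
    s - t ∉ range ((↑) : ℤ → ℝ) → HasDerivAt (fun x => hat x t) (g s t) s
  support : ∀ s t, g s t ≠ 0 → s ∈ Ioo (-1 : ℝ) 1 ∧ t ∈ Ioo (-1 : ℝ) 1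
  integrable : ∀ a b : ℤ, Integrable fun z : ℝ × ℝ => g (z.1 - a) (z.2 - b) * g z.1 z.2

/-- The `L²` inner product of `g` with its translate by the grid vector `(a, b)`. -/
noncomputable def slopeOverlap (g : ℝ → ℝ → ℝ) (a b : ℤ) : ℝ :=
  ∫ z : ℝ × ℝ, g (z.1 - a) (z.2 - b) * g z.1 z.2

theorem integral_translate_mul_translate (g : ℝ → ℝ → ℝ) (a b c d : ℤ) :
    ∫ z : ℝ × ℝ, g (z.1 - a) (z.2 - b) * g (z.1 - c) (z.2 - d) =
      slopeOverlap g (a - c) (b - d) := by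
  simpa only [slopeOverlap, Prod.fst_sub, Prod.snd_sub, Int.cast_sub, sub_sub_sub_cancel_right]
    using integral_sub_right_eq_self (fun z : ℝ × ℝ => g (z.1 - (a - c : ℤ)) (z.2 - (b - d : ℤ)) *
      g z.1 z.2) ((c : ℝ), (d : ℝ))

/-- The pairing `∇φ_q · ∇φ_p` of two nodal gradients, on the grid of mesh size one, when `g` is the
slope of the reference hat function. -/
noncomputable def gradPairing {N : ℕ} (g : ℝ → ℝ → ℝ) (p q : Node N) (s t : ℝ) : ℝ :=
  g (s - xc q) (t - yc q) * g (s - xc p) (t - yc p) +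
    g (t - yc q) (s - xc q) * g (t - yc p) (s - xc p)

theorem integral_unitSquare_comp_mul {c : ℝ} {F : ℝ → ℝ → ℝ}
    (hF : ∀ s t, F s t ≠ 0 → s ∈ Ioc 0 c ∧ t ∈ Ioc 0 c) :
    ∫ t in (0 : ℝ)..1, ∫ s in (0 : ℝ)..1, c * (c * F (c * s) (c * t)) = ∫ t, ∫ s, F s t := by
  have hinner : ∀ t, ∫ s in (0 : ℝ)..1, c * (c * F (c * s) t) = c * ∫ s, F s t := fun t => by
    rw [intervalIntegral.integral_const_mul, intervalIntegral.integral_const_mul,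
      intervalIntegral.mul_integral_comp_mul_left (f := fun s => F s t), mul_zero, mul_one,
      intervalIntegral.integral_eq_integral_of_support_subset fun s hs => (hF s t hs).1]
  have hsupp : (Function.support fun t => ∫ s, F s t) ⊆ Ioc 0 c := fun t ht => by
    obtain ⟨s, hs⟩ : ∃ s, F s t ≠ 0 := by
      by_contra! hzero
      exact ht (by simp only [hzero, integral_zero])
    exact (hF s t hs).2
  simp only [hinner]
  rw [intervalIntegral.integral_const_mul,
    intervalIntegral.mul_integral_comp_mul_left (f := fun t => ∫ s, F s t), mul_zero, mul_one,
    intervalIntegral.integral_eq_integral_of_support_subset hsupp]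

namespace IsSlope

variable {hat g : ℝ → ℝ → ℝ} {N : ℕ}

theorem integrable_translate_mul_translate (h : IsSlope hat g) (a b c d : ℤ) :
    Integrable fun z : ℝ × ℝ => g (z.1 - a) (z.2 - b) * g (z.1 - c) (z.2 - d) := by
  simpa only [Prod.fst_sub, Prod.snd_sub, Int.cast_sub, sub_sub_sub_cancel_right] using
    (h.integrable (a - c) (b - d)).comp_sub_right ((c : ℝ), (d : ℝ))

theorem deriv_basisFun_fst (h : IsSlope hat g) (p : Node N) {s t : ℝ}
    (hs : N * s ∉ range ((↑) : ℤ → ℝ)) (ht : N * t ∉ range ((↑) : ℤ → ℝ))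
    (hst : N * s - N * t ∉ range ((↑) : ℤ → ℝ)) :
    deriv (fun x => basisFun N hat p x t) s = N * g (N * s - xc p) (N * t - yc p) := by
  have hdiff : (N * s - xc p) - (N * t - yc p) ∉ range ((↑) : ℤ → ℝ) := by
    rw [sub_sub_sub_comm, ← Int.cast_sub]
    exact sub_intCast_notMem_range _ hst
  have hinner : HasDerivAt (fun x : ℝ => N * x - xc p) N s := by
    simpa only [mul_one, id] using ((hasDerivAt_id s).const_mul (N : ℝ)).sub_const (xc p : ℝ)
  rw [mul_comm]
  exact ((h.hasDerivAt _ _ (sub_intCast_notMem_range _ hs) (sub_intCast_notMem_range _ ht)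
    hdiff).comp s hinner).deriv

theorem deriv_basisFun_snd (h : IsSlope hat g) (p : Node N) {s t : ℝ}
    (hs : N * s ∉ range ((↑) : ℤ → ℝ)) (ht : N * t ∉ range ((↑) : ℤ → ℝ))
    (hst : N * s - N * t ∉ range ((↑) : ℤ → ℝ)) :
    deriv (fun y => basisFun N hat p s y) t = N * g (N * t - yc p) (N * s - xc p) := by
  have hswap : (fun y => basisFun N hat p s y) = fun y => basisFun N hat p.swap y s :=
    funext fun _ => h.symm _ _
  rw [hswap]
  exact h.deriv_basisFun_fst p.swap ht hs (neg_sub (N * s) _ ▸ neg_notMem_range_intCast hst)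

theorem gradPairing_support (h : IsSlope hat g) (p q : Node N) (s t : ℝ)
    (hst : gradPairing g p q s t ≠ 0) : s ∈ Ioc (0 : ℝ) N ∧ t ∈ Ioc (0 : ℝ) N := by
  have hcoord : ∀ (i : Fin (N - 1)) {x : ℝ}, x - ((i : ℤ) + 1 : ℤ) ∈ Ioo (-1 : ℝ) 1 →
      x ∈ Ioc (0 : ℝ) N := fun i x hx => by
    have hi : ((i : ℕ) : ℝ) + 2 ≤ N := by exact_mod_cast (by omega : (i : ℕ) + 2 ≤ N)
    have hi₀ : (0 : ℝ) ≤ (i : ℕ) := Nat.cast_nonneg _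
    push_cast at hx
    exact ⟨by linarith [hx.1, hi₀], by linarith [hx.2, hi]⟩
  suffices hnear : s - xc p ∈ Ioo (-1 : ℝ) 1 ∧ t - yc p ∈ Ioo (-1 : ℝ) 1 from
    ⟨hcoord p.1 hnear.1, hcoord p.2 hnear.2⟩
  by_cases hx : g (s - xc p) (t - yc p) = 0
  · refine (h.support (t - yc p) (s - xc p) fun hy => hst ?_).symm
    rw [gradPairing, hx, hy, mul_zero, mul_zero, add_zero]
  · exact h.support _ _ hx

theorem integral_gradPairing (h : IsSlope hat g) (p q : Node N) :
    ∫ t, ∫ s, gradPairing g p q s t =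
      slopeOverlap g (xc q - xc p) (yc q - yc p) + slopeOverlap g (yc q - yc p) (xc q - xc p) := by
  have hx := h.integrable_translate_mul_translate (xc q) (yc q) (xc p) (yc p)
  have hy := (h.integrable_translate_mul_translate (yc q) (xc q) (yc p) (xc p)).swap
  rw [← integral_translate_mul_translate, ← integral_translate_mul_translate,
    Measure.volume_eq_prod, ← integral_prod_swap (μ := volume) (ν := volume) fun z : ℝ × ℝ =>
      g (z.1 - yc q) (z.2 - xc q) * g (z.1 - yc p) (z.2 - xc p)]
  exact (integral_prod_symm (fun z : ℝ × ℝ => gradPairing g p q z.1 z.2) (hx.add hy)).symm.trans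
    (integral_add hx hy)

theorem stiffnessMatrix_apply (h : IsSlope hat g) (hN : N ≠ 0) (p q : Node N) :
    stiffnessMatrix N hat p q =
      slopeOverlap g (xc q - xc p) (yc q - yc p) + slopeOverlap g (yc q - yc p) (xc q - xc p) := by
  have hN' : (N : ℝ) ≠ 0 := Nat.cast_ne_zero.2 hN
  rw [← h.integral_gradPairing, ← integral_unitSquare_comp_mul (h.gradPairing_support p q),
    stiffnessMatrix, of_apply]
  refine intervalIntegral.integral_congr_ae ?_
  filter_upwards [ae_mul_sub_notMem_range_intCast hN' 0] with t ht _
  refine intervalIntegral.integral_congr_ae ?_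
  filter_upwards [ae_mul_sub_notMem_range_intCast hN' 0,
    ae_mul_sub_notMem_range_intCast hN' (N * t)] with s hs hst _
  rw [sub_zero] at ht hs
  rw [h.deriv_basisFun_fst q hs ht hst, h.deriv_basisFun_fst p hs ht hst,
    h.deriv_basisFun_snd q hs ht hst, h.deriv_basisFun_snd p hs ht hst, gradPairing]
  ring

end IsSlope

end Stiffness

/-! ### Grid cells -/

section Cells

open MeasureTheory Set

/-- The functions `e i` are orthonormal in `L²(μ)`; the integrability of the products is part of
the definition, because the Bochner integral of a non-integrable function is `0`. -/
structure IsL2Orthonormal {α κ : Type*} [MeasurableSpace α] [DecidableEq κ] (e : κ → α → ℝ)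
    (μ : Measure α) : Prop where
  integrable : ∀ i j, Integrable (fun x => e i x * e j x) μ
  integral : ∀ i j, ∫ x, e i x * e j x ∂μ = if i = j then 1 else 0

namespace IsL2Orthonormal

variable {α β κ ξ : Type*} [MeasurableSpace α] [MeasurableSpace β] [DecidableEq κ] [DecidableEq ξ]
  {e : κ → α → ℝ} {f : ξ → β → ℝ} {μ : Measure α} {ν : Measure β}

theorem integrable_sub_mul_sub (h : IsL2Orthonormal e μ) (i j k l : κ) :
    Integrable (fun x => (e i x - e j x) * (e k x - e l x)) μ := by
  simp only [mul_sub, sub_mul]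
  exact ((h.integrable i k).sub (h.integrable j k)).sub ((h.integrable i l).sub (h.integrable j l))

theorem integral_sub_mul_sub (h : IsL2Orthonormal e μ) (i j k l : κ) :
    ∫ x, (e i x - e j x) * (e k x - e l x) ∂μ =
      (if i = k then 1 else 0) - (if j = k then 1 else 0) -
        ((if i = l then 1 else 0) - if j = l then 1 else 0) := by
  have hik := h.integrable i k
  have hjk := h.integrable j k
  have hil := h.integrable i l
  have hjl := h.integrable j l
  simp only [mul_sub, sub_mul, ← h.integral]
  exact (integral_sub (hik.sub hjk) (hil.sub hjl)).trans
    (congrArg₂ _ (integral_sub hik hjk) (integral_sub hil hjl))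

theorem prod [SFinite μ] [SFinite ν] (he : IsL2Orthonormal e μ) (hf : IsL2Orthonormal f ν) :
    IsL2Orthonormal (fun (i : κ × ξ) (z : α × β) => e i.1 z.1 * f i.2 z.2) (μ.prod ν) where
  integrable i j := by
    simp only [mul_mul_mul_comm]
    exact (he.integrable _ _).mul_prod (hf.integrable _ _)
  integral i j := by
    simp only [mul_mul_mul_comm]
    rw [integral_prod_mul (fun x => e i.1 x * e j.1 x) fun y => f i.2 y * f j.2 y, he.integral,
      hf.integral]
    simp only [Prod.ext_iff, ite_and, mul_ite, mul_one, mul_zero]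
    split_ifs <;> rfl

end IsL2Orthonormal

/-- The indicator function of the open unit interval. -/
noncomputable def unitInd (s : ℝ) : ℝ := if 0 < s ∧ s < 1 then 1 else 0

theorem unitInd_eq_indicator : unitInd = (Ioo (0 : ℝ) 1).indicator 1 := by
  ext s
  simp only [unitInd, indicator_apply, mem_Ioo, Pi.one_apply]

theorem unitInd_mul_self (s : ℝ) : unitInd s * unitInd s = unitInd s := by
  unfold unitInd
  split_ifs <;> norm_num

theorem isL2Orthonormal_unitInd :
    IsL2Orthonormal (fun (i : ℤ) (s : ℝ) => unitInd (s + i)) volume := by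
  have hint : Integrable unitInd := by
    rw [unitInd_eq_indicator]
    exact (integrable_indicator_iff measurableSet_Ioo).2 (integrableOn_const (by simp))
  have hdisjoint : ∀ {i j : ℤ}, i ≠ j → ∀ s : ℝ, unitInd (s + i) * unitInd (s + j) = 0 := by
    intro i j hij s
    by_contra! h
    obtain ⟨hi, hj⟩ := mul_ne_zero_iff.1 h
    simp only [unitInd, ne_eq, ite_eq_right_iff, one_ne_zero, imp_false, not_not] at hi hj
    have hlt : (i : ℝ) < (j + 1 : ℤ) := by push_cast; linarith [hi.2, hj.1]
    have hgt : (j : ℝ) < (i + 1 : ℤ) := by push_cast; linarith [hj.2, hi.1]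
    rw [Int.cast_lt] at hlt hgt
    omega
  refine ⟨fun i j => ?_, fun i j => ?_⟩ <;> obtain rfl | hij := eq_or_ne i j
  · simpa only [unitInd_mul_self] using hint.comp_add_right (i : ℝ)
  · simp only [hdisjoint hij]
    exact integrable_zero ..
  · simp only [unitInd_mul_self, if_true]
    rw [integral_add_right_eq_self unitInd, unitInd_eq_indicator,
      integral_indicator_one measurableSet_Ioo]
    simp
  · simp only [hdisjoint hij, integral_zero, if_neg hij]

end Cells

/-! ### Slopes of hat functions -/

section Slopes

open Set Filter

theorem hasDerivAt_max_const {x c : ℝ} (h : x ≠ c) :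
    HasDerivAt (fun y => max y c) (if c < x then 1 else 0) x := by
  split_ifs with hc
  · exact (hasDerivAt_id x).congr_of_eventuallyEq
      ((lt_mem_nhds hc).mono fun y hy => max_eq_left hy.le)
  · exact (hasDerivAt_const x c).congr_of_eventuallyEq
      ((gt_mem_nhds (lt_of_le_of_ne (not_lt.1 hc) h)).mono fun y hy => max_eq_right hy.le)

theorem hasDerivAt_min_const {x c : ℝ} (h : x ≠ c) :
    HasDerivAt (fun y => min y c) (if x < c then 1 else 0) x := by
  split_ifs with hc
  · exact (hasDerivAt_id x).congr_of_eventuallyEq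
      ((gt_mem_nhds hc).mono fun y hy => min_eq_left hy.le)
  · exact (hasDerivAt_const x c).congr_of_eventuallyEq
      ((lt_mem_nhds (lt_of_le_of_ne (not_lt.1 hc) h.symm)).mono fun y hy => min_eq_right hy.le)

theorem hasDerivAt_max_zero_one_sub {r : ℝ → ℝ} {r' x : ℝ}
    (hr : HasDerivAt r r' x) (hx : r x ≠ 1) :
    HasDerivAt (fun y => max 0 (1 - r y)) (if r x < 1 then -r' else 0) x := by
  have h := (hasDerivAt_max_const (sub_ne_zero.2 hx.symm)).comp x (hr.const_sub 1)
  simpa only [Function.comp_def, max_comm, sub_pos, ite_mul, one_mul, zero_mul] using h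

/-- The slope of the one-dimensional hat function on the unit grid. -/
noncomputable def slope₁ (s : ℝ) : ℝ := unitInd (s + (1 : ℤ)) - unitInd (s + (0 : ℤ))

/-- The one-dimensional hat function. -/
noncomputable def hat₁ (s : ℝ) : ℝ := max 0 (1 - |s|)

theorem hasDerivAt_hat₁ {s : ℝ} (hs : s ∉ range ((↑) : ℤ → ℝ)) :
    HasDerivAt hat₁ (slope₁ s) s := by
  have h0 : s ≠ 0 := fun h => hs ⟨0, by simp [h]⟩
  have h1 : |s| ≠ 1 := fun h => (eq_or_eq_neg_of_abs_eq h).elim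
    (fun h => hs ⟨1, by simp [h]⟩) fun h => hs ⟨-1, by simp [h]⟩
  obtain h0 | h0 := h0.lt_or_gt
  · refine (hasDerivAt_max_zero_one_sub (hasDerivAt_abs_neg h0) h1).congr_deriv ?_
    rw [abs_of_neg h0] at h1 ⊢
    simp only [slope₁, unitInd, Int.cast_zero, Int.cast_one, add_zero]
    grind
  · refine (hasDerivAt_max_zero_one_sub (hasDerivAt_abs_pos h0) h1).congr_deriv ?_
    rw [abs_of_pos h0] at h1 ⊢
    simp only [slope₁, unitInd, Int.cast_zero, Int.cast_one, add_zero]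
    grind

/-- The slope of the P1 hat function in its first variable. In the sheared coordinates `(s, t - s)`
it is the difference of the indicators of two unit squares. -/
noncomputable def slopeP1 (s t : ℝ) : ℝ :=
  unitInd (s + (1 : ℤ)) * unitInd (t - s + (0 : ℤ)) -
    unitInd (s + (0 : ℤ)) * unitInd (t - s + (1 : ℤ))

theorem hatP1_comm (s t : ℝ) : hatP1 s t = hatP1 t s := by
  rw [hatP1, hatP1, max_comm |s|, abs_sub_comm]

theorem hatP1_eq (s t : ℝ) :
    hatP1 s t = max 0 (1 - (max s (max 0 t) - min s (min 0 t))) := by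
  rw [hatP1]
  grind

theorem slopeP1_eq {s t : ℝ} (hs : s ≠ 0) (hst : s ≠ t) :
    slopeP1 s t = if max s (max 0 t) - min s (min 0 t) < 1 then
      (if s < min 0 t then 1 else 0) - (if max 0 t < s then 1 else 0) else 0 := by
  simp only [slopeP1, unitInd, Int.cast_zero, Int.cast_one, add_zero]
  rcases le_total 0 t with ht | ht <;> rcases hs.lt_or_gt with h | h <;>
    rcases hst.lt_or_gt with h' | h' <;> grind

theorem max_sub_min_ne_one {s t : ℝ} (hs : |s| ≠ 1) (ht : |t| ≠ 1) (hst : |s - t| ≠ 1) :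
    max s (max 0 t) - min s (min 0 t) ≠ 1 := by
  rw [ne_eq, abs_eq zero_le_one, not_or] at hs ht hst
  have hmax : max s (max 0 t) ∈ [s, 0, t] := by grind
  have hmin : min s (min 0 t) ∈ [s, 0, t] := by grind
  grind only [= List.mem_cons, = List.mem_nil_iff]

theorem hasDerivAt_hatP1 {s t : ℝ} (hs : s ∉ range ((↑) : ℤ → ℝ))
    (ht : t ∉ range ((↑) : ℤ → ℝ)) (hst : s - t ∉ range ((↑) : ℤ → ℝ)) :
    HasDerivAt (fun x => hatP1 x t) (slopeP1 s t) s := by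
  have hne : ∀ {x : ℝ}, x ∉ range ((↑) : ℤ → ℝ) → |x| ≠ 1 := fun hx h =>
    (eq_or_eq_neg_of_abs_eq h).elim (fun h => hx ⟨1, by simp [h]⟩) fun h => hx ⟨-1, by simp [h]⟩
  have hs0 : s ≠ 0 := fun h => hs ⟨0, by simp [h]⟩
  have hst0 : s ≠ t := fun h => hst ⟨0, by simp [h]⟩
  have hmax : s ≠ max 0 t := by rcases max_choice 0 t with h | h <;> rwa [h]
  have hmin : s ≠ min 0 t := by rcases min_choice 0 t with h | h <;> rwa [h]
  simp only [hatP1_eq]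
  refine (hasDerivAt_max_zero_one_sub ((hasDerivAt_max_const hmax).sub (hasDerivAt_min_const hmin))
    (max_sub_min_ne_one (hne hs) (hne ht) (hne hst))).congr_deriv ?_
  simp only [slopeP1_eq hs0 hst0, Pi.sub_apply, neg_sub]

end Slopes

/-! ### Linear and bilinear elements -/

section Elements

open MeasureTheory Set

theorem mem_Ioo_of_unitInd_ne_zero {s : ℝ} (hs : unitInd s ≠ 0) : s ∈ Ioo (0 : ℝ) 1 :=
  of_not_not fun h => hs (if_neg h)

theorem hat₁_eq_zero {s : ℝ} (hs : 1 ≤ |s|) : hat₁ s = 0 :=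
  max_eq_left (sub_nonpos.2 hs)

theorem hat₁_of_mem_Icc {s : ℝ} (hs : s ∈ Icc (0 : ℝ) 1) : hat₁ s = 1 - s := by
  rw [hat₁, abs_of_nonneg hs.1, max_eq_right (sub_nonneg.2 hs.2)]

theorem hat₁_neg (s : ℝ) : hat₁ (-s) = hat₁ s := by
  rw [hat₁, abs_neg, hat₁]

theorem mem_Ioo_of_hat₁_ne_zero {s : ℝ} (hs : hat₁ s ≠ 0) : s ∈ Ioo (-1 : ℝ) 1 :=
  abs_lt.1 (lt_of_not_ge fun h => hs (hat₁_eq_zero h))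

theorem mem_Ioo_of_slope₁_ne_zero {s : ℝ} (hs : slope₁ s ≠ 0) : s ∈ Ioo (-1 : ℝ) 1 := by
  simp only [slope₁, Int.cast_one, Int.cast_zero, add_zero] at hs
  by_cases hleft : unitInd (s + 1) = 0
  · rw [hleft, zero_sub, neg_ne_zero] at hs
    have h := mem_Ioo_of_unitInd_ne_zero hs
    exact ⟨by linarith [h.1], h.2⟩
  · have h := mem_Ioo_of_unitInd_ne_zero hleft
    exact ⟨by linarith [h.1], by linarith [h.2]⟩

theorem slope₁_sub_intCast (s : ℝ) (d : ℤ) :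
    slope₁ (s - d) = unitInd (s + (1 - d : ℤ)) - unitInd (s + (0 - d : ℤ)) := by
  rw [slope₁, Int.cast_sub, Int.cast_sub, sub_add_eq_add_sub, sub_add_eq_add_sub, add_sub_assoc,
    add_sub_assoc]

theorem integrable_slope₁_mul (d : ℤ) : Integrable fun s : ℝ => slope₁ (s - d) * slope₁ s := by
  simp only [slope₁_sub_intCast]
  exact isL2Orthonormal_unitInd.integrable_sub_mul_sub _ _ _ _

theorem integral_slope₁_mul (d : ℤ) : ∫ s : ℝ, slope₁ (s - d) * slope₁ s = lapWeight d := by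
  simp only [slope₁_sub_intCast]
  refine (isL2Orthonormal_unitInd.integral_sub_mul_sub _ _ _ _).trans ?_
  rw [lapWeight]
  split_ifs <;> first | omega | norm_num

theorem integrable_hat₁_mul (d : ℤ) : Integrable fun t : ℝ => hat₁ (t - d) * hat₁ t := by
  have hcont : Continuous fun t : ℝ => hat₁ (t - d) * hat₁ t := by
    unfold hat₁
    fun_prop
  refine hcont.integrable_of_hasCompactSupport
    (HasCompactSupport.intro (isCompact_Icc (a := (-1 : ℝ)) (b := 1)) fun t ht => ?_)
  by_contra h
  exact ht (Ioo_subset_Icc_self (mem_Ioo_of_hat₁_ne_zero (right_ne_zero_of_mul h)))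

theorem integral_hat₁_mul_self : ∫ t : ℝ, hat₁ t * hat₁ t = 2 / 3 := by
  have hsupp : ∀ t ∈ Ioi (0 : ℝ) \ Ioc 0 1, hat₁ t * hat₁ t = 0 := fun t ht => by
    have ht' : 1 ≤ |t| := (le_of_not_ge fun h => ht.2 ⟨ht.1, h⟩).trans (le_abs_self t)
    rw [hat₁_eq_zero ht', mul_zero]
  have habs : ∀ t : ℝ, hat₁ t * hat₁ t = hat₁ |t| * hat₁ |t| := fun t => by
    rw [hat₁, hat₁, abs_abs]
  have hcongr : EqOn (fun t => hat₁ t * hat₁ t) (fun t => (1 - t) ^ 2) (uIcc 0 1) :=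
    fun t ht => by
      rw [uIcc_of_le zero_le_one] at ht
      simp only [hat₁_of_mem_Icc ht, sq]
  rw [integral_congr_ae (ae_of_all _ habs), integral_comp_abs (f := fun t => hat₁ t * hat₁ t),
    setIntegral_eq_of_subset_of_forall_sdiff_eq_zero measurableSet_Ioi Ioc_subset_Ioi_self hsupp,
    ← intervalIntegral.integral_of_le zero_le_one, intervalIntegral.integral_congr hcongr,
    intervalIntegral.integral_comp_sub_left (fun t : ℝ => t ^ 2), integral_pow]
  norm_num

theorem integral_hat₁_sub_one_mul : ∫ t : ℝ, hat₁ (t - 1) * hat₁ t = 1 / 6 := by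
  have hsupp : (Function.support fun t => hat₁ (t - 1) * hat₁ t) ⊆ Ioc 0 1 := fun t ht =>
    ⟨by linarith [(mem_Ioo_of_hat₁_ne_zero (left_ne_zero_of_mul ht)).1],
      (mem_Ioo_of_hat₁_ne_zero (right_ne_zero_of_mul ht)).2.le⟩
  have hcongr : EqOn (fun t => hat₁ (t - 1) * hat₁ t) (fun t => t - t ^ 2) (uIcc 0 1) :=
    fun t ht => by
      rw [uIcc_of_le zero_le_one] at ht
      have ht' : 1 - t ∈ Icc (0 : ℝ) 1 := ⟨by linarith [ht.2], by linarith [ht.1]⟩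
      simp only [← hat₁_neg (t - 1), neg_sub, hat₁_of_mem_Icc ht, hat₁_of_mem_Icc ht']
      ring
  rw [← intervalIntegral.integral_eq_integral_of_support_subset hsupp,
    intervalIntegral.integral_congr hcongr, intervalIntegral.integral_sub
      intervalIntegral.intervalIntegrable_id (intervalIntegral.intervalIntegrable_pow 2),
    integral_id, integral_pow]
  norm_num

-- On a uniform grid the mass matrix of the hat functions is `1 - lap / 6`.
theorem integral_hat₁_mul (d : ℤ) :
    ∫ t : ℝ, hat₁ (t - d) * hat₁ t = (if d = 0 then 1 else 0) - lapWeight d / 6 := by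
  wlog hd : 0 ≤ d generalizing d
  · have hreflect : ∫ t : ℝ, hat₁ (t - d) * hat₁ t = ∫ t : ℝ, hat₁ (t - (-d : ℤ)) * hat₁ t := by
      rw [← integral_add_right_eq_self _ (d : ℝ)]
      simp only [add_sub_cancel_right, Int.cast_neg, sub_neg_eq_add, mul_comm]
    rw [hreflect, this (-d) (by omega)]
    simp only [lapWeight, neg_eq_zero]
    split_ifs <;> first | omega | rfl
  obtain rfl | rfl | hd : d = 0 ∨ d = 1 ∨ 2 ≤ d := by omega
  · simp only [Int.cast_zero, sub_zero, integral_hat₁_mul_self, lapWeight]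
    norm_num
  · simp only [Int.cast_one, integral_hat₁_sub_one_mul, lapWeight]
    norm_num
  · have hd' : (2 : ℝ) ≤ d := by exact_mod_cast hd
    have hzero : ∀ t : ℝ, hat₁ (t - d) * hat₁ t = 0 := fun t => by
      by_contra h
      linarith [(mem_Ioo_of_hat₁_ne_zero (left_ne_zero_of_mul h)).1,
        (mem_Ioo_of_hat₁_ne_zero (right_ne_zero_of_mul h)).2]
    simp only [hzero, integral_zero, lapWeight]
    rw [if_neg (by omega), if_neg (by omega), if_neg (by omega), zero_div, sub_zero]

/-- The slope of the Q1 hat function in its first variable. -/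
noncomputable def slopeQ1 (s t : ℝ) : ℝ := slope₁ s * hat₁ t

theorem isSlope_hatQ1 : IsSlope hatQ1 slopeQ1 where
  symm _ _ := mul_comm _ _
  hasDerivAt _ t hs _ _ := (hasDerivAt_hat₁ hs).mul_const (hat₁ t)
  support _ _ h := ⟨mem_Ioo_of_slope₁_ne_zero (left_ne_zero_of_mul h),
    mem_Ioo_of_hat₁_ne_zero (right_ne_zero_of_mul h)⟩
  integrable a b := by
    simp only [slopeQ1, mul_mul_mul_comm _ (hat₁ _)]
    exact (integrable_slope₁_mul a).mul_prod (integrable_hat₁_mul b)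

theorem slopeOverlap_slopeQ1 (a b : ℤ) :
    slopeOverlap slopeQ1 a b = lapWeight a * ((if b = 0 then 1 else 0) - lapWeight b / 6) := by
  rw [← integral_slope₁_mul, ← integral_hat₁_mul, slopeOverlap, Measure.volume_eq_prod,
    ← integral_prod_mul]
  simp only [slopeQ1, mul_mul_mul_comm _ (hat₁ _)]

theorem stiffnessMatrix_hatQ1 {N : ℕ} (hN : N ≠ 0) :
    stiffnessMatrix N hatQ1 = ninePointMatrix (N - 1) (-(1 / 3)) := by
  ext p q
  rw [isSlope_hatQ1.stiffnessMatrix_apply hN, slopeOverlap_slopeQ1, slopeOverlap_slopeQ1,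
    ninePointMatrix_apply, ninePointStencil]
  ring

theorem mem_Ioo_of_slopeP1_ne_zero {s t : ℝ} (hst : slopeP1 s t ≠ 0) :
    s ∈ Ioo (-1 : ℝ) 1 ∧ t ∈ Ioo (-1 : ℝ) 1 := by
  simp only [slopeP1, Int.cast_one, Int.cast_zero, add_zero] at hst
  by_cases hleft : unitInd (s + 1) * unitInd (t - s) = 0
  · rw [hleft, zero_sub, neg_ne_zero] at hst
    have hs := mem_Ioo_of_unitInd_ne_zero (left_ne_zero_of_mul hst)
    have ht := mem_Ioo_of_unitInd_ne_zero (right_ne_zero_of_mul hst)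
    exact ⟨⟨by linarith [hs.1], hs.2⟩, by linarith [hs.1, ht.1], by linarith [hs.2, ht.2]⟩
  · have hs := mem_Ioo_of_unitInd_ne_zero (left_ne_zero_of_mul hleft)
    have ht := mem_Ioo_of_unitInd_ne_zero (right_ne_zero_of_mul hleft)
    exact ⟨⟨by linarith [hs.1], by linarith [hs.2]⟩, by linarith [hs.1, ht.1],
      by linarith [hs.2, ht.2]⟩

/-- The indicator functions of the unit squares with integer corners. -/
noncomputable def cellInd (i : ℤ × ℤ) (z : ℝ × ℝ) : ℝ := unitInd (z.1 + i.1) * unitInd (z.2 + i.2)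

theorem isL2Orthonormal_cellInd : IsL2Orthonormal cellInd volume :=
  isL2Orthonormal_unitInd.prod isL2Orthonormal_unitInd

theorem slopeP1_sub_intCast (a b : ℤ) (z : ℝ × ℝ) :
    slopeP1 (z.1 - a) (z.2 - b) =
      cellInd (1 - a, a - b) (z.1, z.2 - z.1) - cellInd (-a, a - b + 1) (z.1, z.2 - z.1) := by
  simp only [slopeP1, cellInd]
  push_cast
  ring_nf

theorem slopeP1_eq_cellInd (z : ℝ × ℝ) :
    slopeP1 z.1 z.2 = cellInd (1, 0) (z.1, z.2 - z.1) - cellInd (0, 1) (z.1, z.2 - z.1) := rfl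

theorem measurePreserving_shear :
    MeasurePreserving (fun z : ℝ × ℝ => (z.1, z.2 - z.1)) volume volume :=
  measurePreserving_prod_sub volume volume

theorem isSlope_hatP1 : IsSlope hatP1 slopeP1 where
  symm := hatP1_comm
  hasDerivAt _ _ := hasDerivAt_hatP1
  support _ _ := mem_Ioo_of_slopeP1_ne_zero
  integrable a b := by
    simp only [slopeP1_sub_intCast, slopeP1_eq_cellInd]
    exact measurePreserving_shear.integrable_comp_of_integrable
      (isL2Orthonormal_cellInd.integrable_sub_mul_sub _ _ _ _)

theorem slopeOverlap_slopeP1 (a b : ℤ) :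
    slopeOverlap slopeP1 a b = lapWeight a * if b = 0 then 1 else 0 := by
  simp only [slopeOverlap, slopeP1_sub_intCast, slopeP1_eq_cellInd]
  refine (measurePreserving_shear.integral_comp
    (MeasurableEquiv.shearSubRight ℝ).measurableEmbedding _).trans
    ((isL2Orthonormal_cellInd.integral_sub_mul_sub (1 - a, a - b) (-a, a - b + 1) (1, 0)
      (0, 1)).trans ?_)
  simp only [lapWeight, Prod.mk.injEq]
  split_ifs <;> first | omega | norm_num

theorem stiffnessMatrix_hatP1 {N : ℕ} (hN : N ≠ 0) :
    stiffnessMatrix N hatP1 = ninePointMatrix (N - 1) 0 := by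
  ext p q
  rw [isSlope_hatP1.stiffnessMatrix_apply hN, slopeOverlap_slopeP1, slopeOverlap_slopeP1,
    ninePointMatrix_apply, ninePointStencil, zero_mul, add_zero, mul_comm (lapWeight (yc q - _))]

end Elements

/-! ### Discretizations -/

theorem Scheme.exists_matrix_eq (d : Scheme) : ∃ γ : ℝ, -(1 / 2) < γ ∧ ∀ N : ℕ, N ≠ 0 →
    ∃ s : ℝ, 0 < s ∧ d.matrix N = s • ninePointMatrix (N - 1) γ := by
  cases d with
  | fdm K hK => exact ⟨K 1 1, hK.neg_half_lt, fun N hN => ⟨N ^ 2, by positivity, hK.fdmMatrix_eq N⟩⟩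
  | femP1 =>
    exact ⟨0, by norm_num, fun N hN =>
      ⟨1, one_pos, (stiffnessMatrix_hatP1 hN).trans (one_smul ℝ _).symm⟩⟩
  | femQ1 =>
    exact ⟨-(1 / 3), by norm_num, fun N hN =>
      ⟨1, one_pos, (stiffnessMatrix_hatQ1 hN).trans (one_smul ℝ _).symm⟩⟩

theorem Scheme.posDef_matrix (d : Scheme) {N : ℕ} (hN : N ≠ 0) : (d.matrix N).PosDef := by
  obtain ⟨γ, hγ, hmatrix⟩ := d.exists_matrix_eq
  obtain ⟨s, hs, hmatrix⟩ := hmatrix N hN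
  rw [hmatrix]
  exact (ninePointMatrix_posDef _ hγ).smul hs

theorem Scheme.exists_approximation (d : Scheme) (π : Prolongation) :
    ∃ ca : ℝ, 0 < ca ∧ ∀ M : ℕ, M ≠ 0 → Approximation (d.matrix (2 * M)) (π.matrix M) ca := by
  obtain ⟨γ, hγ, hmatrix⟩ := d.exists_matrix_eq
  have hpos := one_sub_two_mul_negPart_pos hγ
  refine ⟨(64 * (1 + 2 * |γ|) / (1 - 2 * γ⁻)) ^ 2, by positivity, fun M hM => ?_⟩
  obtain ⟨s, hs, hmatrix⟩ := hmatrix (2 * M) (mul_ne_zero two_ne_zero hM)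
  rw [hmatrix]
  exact approximation_smul_ninePointMatrix hγ hs π M

theorem card_node_lt_card_node_two_mul {M : ℕ} (hM : M ≠ 0) :
    Fintype.card (Node M) < Fintype.card (Node (2 * M)) := by
  simp only [Node, Fintype.card_prod, Fintype.card_fin]
  exact Nat.mul_self_lt_mul_self (by omega)

end MetaMgNet

open MetaMgNet in
theorem mainTheorem2_general :
    (∃ cs : ℝ, 0 < cs ∧ ∀ (d : Scheme) (M : ℕ), 1 ≤ M →
      ∀ (μ : Type) [Fintype μ] [DecidableEq μ]
        (𝒢 : (Node (2 * M) → ℝ) → Matrix (Node (2 * M)) μ ℝ),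
        Admissible 𝒢 → SmootherProperty (d.matrix (2 * M)) 𝒢 cs) ∧
    ∀ (d : Scheme) (π : Prolongation),
      (∃ ca : ℝ, 0 < ca ∧ ∀ M : ℕ, 1 ≤ M →
        (d.matrix (2 * M)).PosDef ∧
        (coarseMatrix (d.matrix (2 * M)) (π.matrix M)).PosDef ∧
        Stability (d.matrix (2 * M)) (π.matrix M) ∧
        Approximation (d.matrix (2 * M)) (π.matrix M) ca) ∧
      ∀ (M : ℕ), 1 ≤ M → ∀ (μ : Type) [Fintype μ] [DecidableEq μ]
        (𝒢 : (Node (2 * M) → ℝ) → Matrix (Node (2 * M)) μ ℝ) (ca cs : ℝ), 0 < ca → 0 < cs →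
        Approximation (d.matrix (2 * M)) (π.matrix M) ca →
        SmootherProperty (d.matrix (2 * M)) 𝒢 cs →
          0 ≤ 1 - 1 / (ca * cs) ∧ 1 - 1 / (ca * cs) < 1 ∧
          ∀ f u u₀ : Node (2 * M) → ℝ, d.matrix (2 * M) *ᵥ u = f → ∀ t : ℕ,
            energyNorm (d.matrix (2 * M))
                (u - iterates (d.matrix (2 * M)) (π.matrix M) 𝒢 f u₀ t) ≤
              (1 - 1 / (ca * cs)) ^ ((t : ℝ) / 2) * energyNorm (d.matrix (2 * M)) (u - u₀) := by
  have hposDef : ∀ (d : Scheme) {M : ℕ}, 1 ≤ M → (d.matrix (2 * M)).PosDef :=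
    fun d M hM => d.posDef_matrix (by omega)
  refine ⟨⟨1, one_pos, fun d M hM μ _ _ 𝒢 h𝒢 => smootherProperty_one (hposDef d hM) h𝒢⟩,
    fun d π => ⟨?_, fun M hM μ _ _ 𝒢 ca cs hca hcs happ hsm => ?_⟩⟩
  · obtain ⟨ca, hca, happ⟩ := d.exists_approximation π
    exact ⟨ca, hca, fun M hM => ⟨hposDef d hM,
      coarseMatrix_posDef (hposDef d hM) (prolongation_injective π M),
      stability_of_posSemidef (hposDef d hM).posSemidef _, happ M (by omega)⟩⟩
  · have hone : 1 ≤ ca * cs := one_le_mul_of_approximation_of_smootherProperty (hposDef d hM)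
      (card_node_lt_card_node_two_mul (by omega)) hca.le hcs.le happ hsm
    have hδ : 0 ≤ 1 - 1 / (ca * cs) := sub_nonneg.2 ((div_le_one (by positivity)).2 hone)
    refine ⟨hδ, sub_lt_self _ (by positivity), ?_⟩
    rintro f u u₀ rfl t
    exact energyNorm_sub_iterates_le (hposDef d hM).posSemidef hca hcs hδ happ hsm u u₀ t

theorem mainTheorem2 :
    -- the smoother property holds with one constant `cs` for all schemes, meshes and Meta-NNs
    (∃ cs : ℝ, 0 < cs ∧ ∀ (d : MetaMgNet.Scheme) (M : ℕ), 1 ≤ M → ∀ (L : ℕ)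
      (𝒢 : (MetaMgNet.Node (2 * M) → ℝ) → Matrix (MetaMgNet.Node (2 * M)) (Fin L) ℝ),
      MetaMgNet.Admissible 𝒢 → MetaMgNet.SmootherProperty (d.matrix (2 * M)) 𝒢 cs) ∧
    ∀ (d : MetaMgNet.Scheme) (π : MetaMgNet.Prolongation),
      -- stability and approximation, with `ca` independent of the mesh
      (∃ ca : ℝ, 0 < ca ∧ ∀ M : ℕ, 1 ≤ M →
        (d.matrix (2 * M)).PosDef ∧
        (MetaMgNet.coarseMatrix (d.matrix (2 * M)) (π.matrix M)).PosDef ∧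
        MetaMgNet.Stability (d.matrix (2 * M)) (π.matrix M) ∧
        MetaMgNet.Approximation (d.matrix (2 * M)) (π.matrix M) ca) ∧
      -- geometric convergence, for any constants for which the two inequalities hold
      ∀ (M : ℕ), 1 ≤ M → ∀ (L : ℕ)
        (𝒢 : (MetaMgNet.Node (2 * M) → ℝ) → Matrix (MetaMgNet.Node (2 * M)) (Fin L) ℝ),
        MetaMgNet.Admissible 𝒢 → ∀ ca cs : ℝ, 0 < ca → 0 < cs →
        MetaMgNet.Approximation (d.matrix (2 * M)) (π.matrix M) ca →
        MetaMgNet.SmootherProperty (d.matrix (2 * M)) 𝒢 cs →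
          0 ≤ 1 - 1 / (ca * cs) ∧ 1 - 1 / (ca * cs) < 1 ∧
          ∀ f u u₀ : MetaMgNet.Node (2 * M) → ℝ, d.matrix (2 * M) *ᵥ u = f → ∀ t : ℕ,
            MetaMgNet.energyNorm (d.matrix (2 * M))
                (u - MetaMgNet.iterates (d.matrix (2 * M)) (π.matrix M) 𝒢 f u₀ t) ≤
              (1 - 1 / (ca * cs)) ^ ((t : ℝ) / 2) *
                MetaMgNet.energyNorm (d.matrix (2 * M)) (u - u₀) :=
  have h := mainTheorem2_general
  ⟨h.1.imp fun _ hcs => ⟨hcs.1, fun d M hM L => hcs.2 d M hM (Fin L)⟩, fun d π =>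
    ⟨(h.2 d π).1, fun M hM L 𝒢 _ => (h.2 d π).2 M hM (Fin L) 𝒢⟩⟩
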